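/- **Lemma (The Lifting Lemma).** *The Special Homeomorphism $T(D,C)$ on $X(D,C)$ has the Lifting Property for the inverse system $(\mathcal W_n,R_n)_{n\ge 0}$ with projections $\xi$.* Explicitly: let $d$ be any metric on $X=X(D,C)$ inducing its topology and let $T=T(D,C)$. For every $n\ge 0$, every continuous surjection $\phi:X\to\mathcal W_n$ mapping $T$ to $R_n$, and every $\epsilon>0$, there are an integer $k\ge 1$ and a continuous surjection $\rho:X\to\mathcal W_{n+k}$ mapping $T$ to $R_{n+k}$ such that $\phi=\xi\circ\rho$, where $\xi:\mathcal W_{n+k}\to\mathcal W_n$ is the composed projection, and the mesh of $\rho$ (the largest $d$-diameter of a preimage $\rho^{-1}(w)$, $w\in\mathcal W_{n+k}$) is at most $\epsilon$. Here finite sets are discrete, and a surjection $\phi:X\to W$ maps $T$ to a relation $R\subset W\times W$ when $R=\{(\phi(x),\phi(Tx)):x\in X\}$. *The homeomorphism.* Let $\Theta=\varprojlim \mathbb Z/m\mathbb Z$ be the inverse limit over the positive integers $m$ ordered by divisibility. For $G=\Theta$ or $G=\mathbb Z/m\mathbb Z$ let $$\Sigma(G)=\{(x,t)\in(\mathbb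 Z\cup\{\pm\infty\})\times G:\ x=\pm\infty,\ \text{or } x\in\mathbb Z \text{ and } t \text{ is the image of } x \text{ in } G\},\qquad \tau(x,t)=(x+1,t+1).$$ The spiral is $\Sigma=\Sigma(\Theta)$. Let $C\subset[0,1]$ be the classical ternary Cantor set and let $D\supset C$ be the set of the points with a ternary expansion $.a_0a_1a_2\dots$ whose smallest index $i$ with $a_i=1$, if any, is even; so among the open middle thirds removed in the construction of $C$, the set $D$ contains those of length $3^{-1},3^{-3},\dots$ and is disjoint from those of length $3^{-2},3^{-4},\dots$. Let $\mathcal J$ be the set of the components $j=(j_-,j_+)$ of $D\setminus C$. Then $Z=Z(D,C)$ is obtained from the disjoint union of $\mathcal J\times\Sigma$ and $C\times\Theta$ by identifying $(j,(-\infty,t))$ with $(j_-,t)$ and $(j,(+\infty,t))$ with $(j_+,t)$ for all $j\in\mathcal J$, $t\in\Theta$. Let $\zeta:Z\to\Theta$ be the $\Theta$-coordinate, and let $q:Z\to D$ send $(a,t)\in C\times\Theta$ to $a$ and map the points $(j,(x,t))$, $x\in\mathbb Z$, of each $j\in\mathcal J$ to a strictly increasing sequence in $j$, indexed by $x$, that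 converges to $j_\pm$ as $x\to\pm\infty$. The topology of $Z$ is the one that makes $q\times\zeta:Z\to\mathbb R\times\Theta$ an embedding; it does not depend on the choice of the sequences. The homeomorphism $\tau_{(D,C)}$ of $Z$ is $(j,p)\mapsto(j,\tau(p))$ on $\mathcal J\times\Sigma$ and $(a,t)\mapsto(a,t+1)$ on $C\times\Theta$. Finally $X(D,C)=Z\times C$, with the product topology, and $T(D,C)=\tau_{(D,C)}\times 1_C$. *The inverse system.* The finite spiral $\Sigma_n$ is the quotient of $\Sigma(\mathbb Z/n!\mathbb Z)$ by the equivalence relation generated by identifying $(x,t)$ with $(+\infty,t)$ for integers $x\ge n$, and $(x,t)$ with $(-\infty,t)$ for integers $x\le -n$. The relation $R_n$ on $\Sigma_n$ is the image of the graph of $\tau$. Let $\xi_M:\Sigma_{n+1}\to\Sigma_n$ be the map induced by $(x,t)\mapsto(x,t\bmod n!)$, and let $\xi_L,\xi_R:\Sigma_{n+1}\to\Sigma_n$ be the maps induced by $(x,t)\mapsto(-\infty,t\bmod n!)$ and $(x,t)\mapsto(+\infty,t\bmod n!)$. Put $\mathcal W_n=B_n\times\Sigma_n$, where $B_n$ is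 the set of the words of length $n$ in the six letters $L_1,L_2,M_1,M_2,R_1,R_2$. The relation $R_n$ on $\mathcal W_n$ consists of the pairs $((\omega,a),(\omega,b))$ with $\omega\in B_n$ and $(a,b)\in R_n$ on $\Sigma_n$. The projection $\xi:\mathcal W_{n+1}\to\mathcal W_n$ is $\xi(\omega K_\alpha,s)=(\omega,\xi_K(s))$ for $\omega\in B_n$, $K\in\{L,M,R\}$, $\alpha\in\{1,2\}$. -/

import Mathlib

open Topology Set

noncomputable section

namespace LiftingLemma

/-! ### Profinite integers, spirals and finite spirals -/

/-- The universal adding machine group `Θ`: the inverse limit of the rings `ℤ/mℤ`, `m ≥ 1`,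
along divisibility, as a subring of the product. -/
def Theta : Subring (∀ m : ℕ+, ZMod m) where
  carrier := {f | ∀ (m n : ℕ+) (h : (m : ℕ) ∣ (n : ℕ)), ZMod.castHom h (ZMod m) (f n) = f m}
  mul_mem' := fun ha hb m n h => by simp only [Pi.mul_apply, map_mul, ha m n h, hb m n h]
  one_mem' := fun m n h => by simp only [Pi.one_apply, map_one]
  add_mem' := fun ha hb m n h => by simp only [Pi.add_apply, map_add, ha m n h, hb m n h]
  zero_mem' := fun m n h => by simp only [Pi.zero_apply, map_zero]
  neg_mem' := fun ha m n h => by simp only [Pi.neg_apply, map_neg, ha m n h]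

/-- The points `(x, t)` of `{±∞} ∪ ℤ` times `G` such that `x = ±∞`, or `x ∈ ℤ` and `t` is the
image of `x` in the ring `G`. For `G = Θ` this is the spiral `Σ`, for `G = ℤ/n!` the
approximation `Σ̃ₙ` with periodic orbits at the ends. -/
inductive Spiral (G : Type) : Type
  /-- the point `(-∞, t)` -/
  | negInf (t : G)
  /-- the wandering point `(x, x)`, for an integer `x` -/
  | int (x : ℤ)
  /-- the point `(+∞, t)` -/
  | posInf (t : G)

namespace Spiral

variable {G H : Type} [Ring G] [Ring H]

/-- The second coordinate `ζ(x, t) = t`. -/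
def zeta : Spiral G → G
  | negInf t => t
  | int x => (x : G)
  | posInf t => t

/-- The homeomorphism `τ(x, t) = (x + 1, t + 1)`. -/
def shift : Spiral G ≃ Spiral G where
  toFun
    | negInf t => negInf (t + 1)
    | int x => int (x + 1)
    | posInf t => posInf (t + 1)
  invFun
    | negInf t => negInf (t - 1)
    | int x => int (x - 1)
    | posInf t => posInf (t - 1)
  left_inv p := by cases p <;> simp
  right_inv p := by cases p <;> simp

/-- The map `(x, t) ↦ (x, f t)` induced by a ring homomorphism `f`. -/
def map (f : G →+* H) : Spiral G → Spiral H
  | negInf t => negInf (f t)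
  | int x => int x
  | posInf t => posInf (f t)

/-- An order preserving embedding of `ℤ` in `(0, 1)` as a sequence converging to `0` at `-∞` and
to `1` at `+∞`. -/
def intPos (x : ℤ) : ℝ := (1 + (x : ℝ) / (1 + |(x : ℝ)|)) / 2

theorem intPos_of_nonneg (x : ℤ) (hx : 0 ≤ x) : intPos x = 1 - 1 / (2 * (1 + (x : ℝ))) := by
  have h : (0 : ℝ) ≤ x := by exact_mod_cast hx
  rw [intPos, abs_of_nonneg h]
  field_simp
  ring

theorem intPos_neg (x : ℤ) : intPos (-x) = 1 - intPos x := by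
  simp only [intPos, Int.cast_neg, abs_neg]
  ring

theorem intPos_step_nonneg (x : ℤ) (hx : 0 ≤ x) :
    intPos x < intPos (x + 1) ∧ intPos (x + 1) - intPos x ≤ 1 - intPos (x + 1) ∧
      1 / 2 ≤ intPos x := by
  have h : (0 : ℝ) ≤ x := by exact_mod_cast hx
  rw [intPos_of_nonneg x hx, intPos_of_nonneg (x + 1) (by omega)]
  push_cast
  have e1 : 1 / (2 * (1 + (x : ℝ))) - 1 / (2 * (1 + (x + 1))) =
      1 / (2 * (1 + x) * (2 + x)) := by
    field_simp
    ring
  have p : 0 < 1 / (2 * (1 + (x : ℝ)) * (2 + x)) := by positivity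
  have e2 : 1 / (2 * (1 + (x : ℝ)) * (2 + x)) ≤ 1 / (2 * (1 + (x + 1))) := by
    apply one_div_le_one_div_of_le (by positivity)
    nlinarith
  have e3 : 1 / (2 * (1 + (x : ℝ))) ≤ 1 / 2 := by
    apply one_div_le_one_div_of_le (by positivity)
    linarith
  refine ⟨by linarith, by linarith, by linarith⟩

theorem intPos_step_neg (x : ℤ) (hx : x < 0) :
    intPos x < intPos (x + 1) ∧ intPos (x + 1) - intPos x ≤ intPos x ∧
      intPos (x + 1) ≤ 1 / 2 := by
  obtain ⟨h1, h2, h3⟩ := intPos_step_nonneg (-(x + 1)) (by omega)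
  rw [show -(x + 1) + 1 = -x by ring, intPos_neg, intPos_neg] at h1 h2
  rw [intPos_neg] at h3
  exact ⟨by linarith, by linarith, by linarith⟩

theorem intPos_strictMono : StrictMono intPos := by
  refine strictMono_int_of_lt_succ fun x => ?_
  rcases le_or_gt 0 x with hx | hx
  · exact (intPos_step_nonneg x hx).1
  · exact (intPos_step_neg x hx).1

theorem intPos_mem (x : ℤ) : intPos x ∈ Ioo (0 : ℝ) 1 := by
  have h : ∀ x : ℤ, intPos x < 1 := fun x => by
    refine (intPos_strictMono.monotone (le_max_left x 0)).trans_lt ?_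
    have h : (0 : ℝ) ≤ (max x 0 : ℤ) := by exact_mod_cast le_max_right x 0
    rw [intPos_of_nonneg _ (le_max_right x 0)]
    have : 0 < 1 / (2 * (1 + ((max x 0 : ℤ) : ℝ))) := by positivity
    linarith
  have h' := h (-x)
  rw [intPos_neg] at h'
  exact ⟨by linarith, h x⟩

theorem intPos_step (x : ℤ) :
    |intPos (x + 1) - intPos x| ≤ min (intPos x) (1 - intPos x) ∧
    |intPos x - intPos (x + 1)| ≤ min (intPos (x + 1)) (1 - intPos (x + 1)) := by
  rw [abs_sub_comm (intPos x), abs_of_pos (sub_pos.2 (intPos_strictMono (lt_add_one x)))]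
  have m := intPos_mem x
  have m' := intPos_mem (x + 1)
  rw [le_min_iff, le_min_iff]
  rcases le_or_gt 0 x with hx | hx
  · obtain ⟨h1, h2, h3⟩ := intPos_step_nonneg x hx
    exact ⟨⟨by linarith [m'.2], by linarith⟩, by linarith, by linarith⟩
  · obtain ⟨h1, h2, h3⟩ := intPos_step_neg x hx
    exact ⟨⟨by linarith, by linarith⟩, by linarith, by linarith⟩

/-- The position in `[0, 1]` of a point `(x, t)`, depending only on `x`: it is `0` for `x = -∞`,
`1` for `x = +∞`, and it embeds `ℤ` in `(0, 1)`. -/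
def pos : Spiral G → ℝ
  | negInf _ => 0
  | int x => intPos x
  | posInf _ => 1

theorem abs_pos_shift_sub_le (p : Spiral G) :
    |(shift p).pos - p.pos| ≤ min p.pos (1 - p.pos) := by
  rcases p with t | x | t
  · simp [shift, pos]
  · exact (intPos_step x).1
  · simp [shift, pos]

theorem abs_pos_shift_symm_sub_le (p : Spiral G) :
    |(shift.symm p).pos - p.pos| ≤ min p.pos (1 - p.pos) := by
  rcases p with t | x | t
  · simp [shift, pos]
  · have h := (intPos_step (x - 1)).2
    rw [sub_add_cancel] at h
    exact h
  · simp [shift, pos]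

end Spiral

/-- The identifications that turn `Σ̃ₙ` into the finite spiral `Σₙ`: `(x, t)` with `(+∞, t)` for
`x ≥ n`, and `(x, t)` with `(-∞, t)` for `x ≤ -n`. -/
inductive Collapse (n : ℕ) : Spiral (ZMod n.factorial) → Spiral (ZMod n.factorial) → Prop
  | right (x : ℤ) (hx : (n : ℤ) ≤ x) : Collapse n (.int x) (.posInf (x : ZMod n.factorial))
  | left (x : ℤ) (hx : x ≤ -(n : ℤ)) : Collapse n (.int x) (.negInf (x : ZMod n.factorial))

/-- The finite spiral `Σₙ`, the quotient of `Σ̃ₙ` by the equivalence relation generated by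
`Collapse n`. -/
def FinSpiral (n : ℕ) : Type := Quot (Collapse n)

namespace FinSpiral

/-- The quotient map `Σ̃ₙ → Σₙ`. -/
def mk (n : ℕ) (p : Spiral (ZMod n.factorial)) : FinSpiral n := Quot.mk _ p

/-- The relation `Rₙ` on `Σₙ`: the image of (the graph of) `τ` under the quotient map. -/
def Rel (n : ℕ) : FinSpiral n → FinSpiral n → Prop :=
  Relation.Map (fun p q => Spiral.shift p = q) (mk n) (mk n)

/-- The projection `ℤ/(n+1)! → ℤ/n!`. -/
def castFact (n : ℕ) : ZMod (n + 1).factorial →+* ZMod n.factorial :=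
  ZMod.castHom (Nat.factorial_dvd_factorial n.le_succ) (ZMod n.factorial)

/-- The canonical projection `ξ_M : Σₙ₊₁ → Σₙ`. -/
def xiM (n : ℕ) : FinSpiral (n + 1) → FinSpiral n :=
  Quot.lift (fun p => mk n (Spiral.map (castFact n) p)) (by
    rintro _ _ (⟨x, hx⟩ | ⟨x, hx⟩)
    · simp only [Spiral.map, map_intCast]
      exact Quot.sound (.right x (by push_cast at hx; omega))
    · simp only [Spiral.map, map_intCast]
      exact Quot.sound (.left x (by push_cast at hx; omega)))

/-- The left collapse `ξ_L : Σₙ₊₁ → Σₙ`, `(x, t) ↦ (-∞, t mod n!)`. -/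
def xiL (n : ℕ) : FinSpiral (n + 1) → FinSpiral n :=
  Quot.lift (fun p => mk n (.negInf (castFact n p.zeta))) (by
    rintro _ _ (⟨x, hx⟩ | ⟨x, hx⟩) <;> rfl)

/-- The right collapse `ξ_R : Σₙ₊₁ → Σₙ`, `(x, t) ↦ (+∞, t mod n!)`. -/
def xiR (n : ℕ) : FinSpiral (n + 1) → FinSpiral n :=
  Quot.lift (fun p => mk n (.posInf (castFact n p.zeta))) (by
    rintro _ _ (⟨x, hx⟩ | ⟨x, hx⟩) <;> rfl)

end FinSpiral

/-! ### The inverse system `(𝒲ₙ, Rₙ)` -/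

/-- The three types of letters `L`, `M`, `R`. -/
inductive Kind : Type
  | L
  | M
  | R

/-- The six letter alphabet `{L₁, L₂, M₁, M₂, R₁, R₂}`. -/
abbrev Letter : Type := Kind × Fin 2

/-- `𝒲ₙ = Bₙ × Σₙ`, with `Bₙ` the set of words of length `n`; a discrete space. -/
def W (n : ℕ) : Type := (Fin n → Letter) × FinSpiral n

instance (n : ℕ) : TopologicalSpace (W n) := ⊥

instance (n : ℕ) : DiscreteTopology (W n) := ⟨rfl⟩

namespace W

/-- The relation `Rₙ` on `𝒲ₙ`: the relation `Rₙ` on each of the finite spirals `{ω} × Σₙ`. -/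
def Rel (n : ℕ) (a b : W n) : Prop := a.1 = b.1 ∧ FinSpiral.Rel n a.2 b.2

/-- The projection `ξ : 𝒲ₙ₊₁ → 𝒲ₙ`: on the spiral of the word `ωK_α` it is `ξ_K`, with values
in the spiral of the word `ω`. -/
def xi (n : ℕ) (a : W (n + 1)) : W n :=
  (Fin.init a.1,
    match (a.1 (Fin.last n)).1 with
    | .L => FinSpiral.xiL n a.2
    | .M => FinSpiral.xiM n a.2
    | .R => FinSpiral.xiR n a.2)

/-- The composition `ξ : 𝒲ₙ₊ₖ → ⋯ → 𝒲ₙ₊₁ → 𝒲ₙ`. -/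
def xiIter (n : ℕ) : ∀ k : ℕ, W (n + k) → W n
  | 0 => id
  | k + 1 => xiIter n k ∘ xi (n + k)

end W

/-! ### The Lifting Property -/

/-- The mesh of a map: the supremum of the diameters of the preimages of points. -/
def mesh {X Y : Type*} [MetricSpace X] (φ : X → Y) : ENNReal := ⨆ y : Y, Metric.ediam (φ ⁻¹' {y})

/-- `φ` is a continuous surjection of `X` onto `𝒲ₙ` that maps `T` to `Rₙ`, that is, the image of
the graph of `T` under `φ × φ` is `Rₙ`. -/
structure IsActionMap {X : Type*} [TopologicalSpace X] (T : X ≃ₜ X) {n : ℕ} (φ : X → W n) :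
    Prop where
  continuous : Continuous φ
  surjective : Function.Surjective φ
  map_rel : Relation.Map (fun x y => T x = y) φ φ = W.Rel n

/-- The Lifting Property of a homeomorphism of a metric space, for the inverse system
`(𝒲ₙ, Rₙ; ξ)`. -/
def LiftingProperty {X : Type*} [MetricSpace X] (T : X ≃ₜ X) : Prop :=
  ∀ (n : ℕ) (φ : X → W n), IsActionMap T φ → ∀ ε : ℝ, 0 < ε →
    ∃ k : ℕ, 0 < k ∧ ∃ ρ : X → W (n + k),
      IsActionMap T ρ ∧ mesh ρ ≤ ENNReal.ofReal ε ∧ φ = W.xiIter n k ∘ ρ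

/-! ### Spaces of spirals -/

/-- The components `j = (j₋, j₊)` of `A \ A₀`, given by their endpoints. For compact `A ⊇ A₀` with
`A₀` containing the boundary of `A`, these are the open intervals contained in `A \ A₀` whose
endpoints are in `A₀`. -/
structure Gap (A A₀ : Set ℝ) : Type where
  /-- the left endpoint `j₋` -/
  l : ℝ
  /-- the right endpoint `j₊` -/
  r : ℝ
  lt : l < r
  l_mem : l ∈ A₀
  r_mem : r ∈ A₀
  sub : Ioo l r ⊆ A \ A₀

/-- The identifications `(j, -∞, t) = (j₋, t)` and `(j, +∞, t) = (j₊, t)`. -/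
inductive Glue (A A₀ : Set ℝ) : (Gap A A₀ × Spiral Theta) ⊕ (A₀ × Theta) →
    (Gap A A₀ × Spiral Theta) ⊕ (A₀ × Theta) → Prop
  | left (j : Gap A A₀) (t : Theta) :
      Glue A A₀ (.inl (j, .negInf t)) (.inr (⟨j.l, j.l_mem⟩, t))
  | right (j : Gap A A₀) (t : Theta) :
      Glue A A₀ (.inl (j, .posInf t)) (.inr (⟨j.r, j.r_mem⟩, t))

/-- The space of spirals `Z(A, A₀)`. It carries the topology that makes `q × ζ` below an
embedding, not the quotient topology of the disjoint union. -/
def Z (A A₀ : Set ℝ) : Type := Quot (Glue A A₀)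

namespace Z

variable {A A₀ : Set ℝ}

/-- The quotient map. -/
def mk (p : (Gap A A₀ × Spiral Theta) ⊕ (A₀ × Theta)) : Z A A₀ := Quot.mk _ p

/-- The map `q : Z(A, A₀) → A ⊆ ℝ` that is the projection to `A₀` on the adding machines and
embeds the wandering orbit of each spiral in the corresponding interval `j`, in an order
preserving manner and converging to the endpoints of `j`. -/
def q : Z A A₀ → ℝ :=
  Quot.lift
    (Sum.elim (fun p => p.1.l + (p.1.r - p.1.l) * p.2.pos) (fun p => (p.1 : ℝ))) (by
    rintro _ _ (⟨j, t⟩ | ⟨j, t⟩) <;> simp [Spiral.pos])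

/-- The map `ζ : Z(A, A₀) → Θ`. -/
def zeta : Z A A₀ → Theta :=
  Quot.lift (Sum.elim (fun p => p.2.zeta) (fun p => p.2)) (by
    rintro _ _ (⟨j, t⟩ | ⟨j, t⟩) <;> rfl)

/-- The topology of `Z(A, A₀)` is induced by `q × ζ : Z(A, A₀) → ℝ × Θ`. It does not depend on the
choice of the sequence `Spiral.intPos`. -/
instance : TopologicalSpace (Z A A₀) :=
  TopologicalSpace.induced (fun z => (q z, zeta z)) inferInstance

/-- The bijection `τ` of `Z(A, A₀)` that is `τ` on each spiral and on each adding machine. -/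
def shiftEquiv (A A₀ : Set ℝ) : Z A A₀ ≃ Z A A₀ where
  toFun := Quot.map (Sum.map (fun p => (p.1, Spiral.shift p.2)) (fun p => (p.1, p.2 + 1))) (by
    rintro _ _ (⟨j, t⟩ | ⟨j, t⟩)
    · exact Glue.left j (t + 1)
    · exact Glue.right j (t + 1))
  invFun := Quot.map
      (Sum.map (fun p => (p.1, Spiral.shift.symm p.2)) (fun p => (p.1, p.2 - 1))) (by
    rintro _ _ (⟨j, t⟩ | ⟨j, t⟩)
    · exact Glue.left j (t - 1)
    · exact Glue.right j (t - 1))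
  left_inv := by
    rintro ⟨⟨j, p⟩ | ⟨a, t⟩⟩
    · exact congrArg (fun p' => mk (.inl (j, p'))) (Spiral.shift.symm_apply_apply p)
    · exact congrArg (fun t' => mk (.inr (a, t'))) (add_sub_cancel_right t 1)
  right_inv := by
    rintro ⟨⟨j, p⟩ | ⟨a, t⟩⟩
    · exact congrArg (fun p' => mk (.inl (j, p'))) (Spiral.shift.apply_symm_apply p)
    · exact congrArg (fun t' => mk (.inr (a, t'))) (sub_add_cancel t 1)

theorem normal_form (z : Z A A₀) :
    (∃ (a : A₀) (t : Theta), z = mk (.inr (a, t))) ∨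
      ∃ (j : Gap A A₀) (x : ℤ), z = mk (.inl (j, .int x)) := by
  rcases z with ⟨⟨j, t | x | t⟩ | ⟨a, t⟩⟩
  · exact Or.inl ⟨_, t, Quot.sound (.left j t)⟩
  · exact Or.inr ⟨j, x, rfl⟩
  · exact Or.inl ⟨_, t, Quot.sound (.right j t)⟩
  · exact Or.inl ⟨a, t, rfl⟩

theorem q_int_mem (j : Gap A A₀) (x : ℤ) :
    (q (mk (.inl (j, .int x)) : Z A A₀)) ∈ Ioo j.l j.r := by
  have h := Spiral.intPos_mem x
  have hj := j.lt
  change j.l + (j.r - j.l) * Spiral.intPos x ∈ _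
  constructor <;> nlinarith [h.1, h.2]

theorem eq_int_of_q_mem (j : Gap A A₀) (x : ℤ) (z : Z A A₀)
    (h : q z ∈ Ioo (q (mk (.inl (j, .int (x - 1))) : Z A A₀))
      (q (mk (.inl (j, .int (x + 1))) : Z A A₀))) :
    z = mk (.inl (j, .int x)) := by
  have hz : q z ∈ Ioo j.l j.r := ⟨(q_int_mem j _).1.trans h.1, h.2.trans (q_int_mem j _).2⟩
  rcases normal_form z with ⟨a, t, rfl⟩ | ⟨i, y, rfl⟩
  · exact absurd a.2 (j.sub hz).2
  · obtain rfl : i = j := by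
      have hi := q_int_mem i y
      have h1 := fun h => (i.sub h).2 j.l_mem
      have h2 := fun h => (i.sub h).2 j.r_mem
      have h3 := fun h => (j.sub h).2 i.l_mem
      have h4 := fun h => (j.sub h).2 i.r_mem
      have hl : i.l = j.l := by
        rcases lt_trichotomy i.l j.l with h | h | h
        · exact (h1 ⟨h, hz.1.trans hi.2⟩).elim
        · exact h
        · exact (h3 ⟨h, hi.1.trans hz.2⟩).elim
      have hr : i.r = j.r := by
        rcases lt_trichotomy i.r j.r with h | h | h
        · exact (h4 ⟨hz.1.trans hi.2, h⟩).elim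
        · exact h
        · exact (h2 ⟨hi.1.trans hz.2, h⟩).elim
      cases i; cases j; cases hl; cases hr; rfl
    change i.l + (i.r - i.l) * Spiral.intPos y ∈
      Ioo (i.l + (i.r - i.l) * Spiral.intPos (x - 1))
        (i.l + (i.r - i.l) * Spiral.intPos (x + 1)) at h
    have hi : 0 < i.r - i.l := sub_pos.2 i.lt
    have h1 := Spiral.intPos_strictMono.lt_iff_lt.1
      (lt_of_mul_lt_mul_left (by linarith [h.1]) hi.le :
        Spiral.intPos (x - 1) < Spiral.intPos y)
    have h2 := Spiral.intPos_strictMono.lt_iff_lt.1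
      (lt_of_mul_lt_mul_left (by linarith [h.2]) hi.le :
        Spiral.intPos y < Spiral.intPos (x + 1))
    obtain rfl : y = x := by omega
    rfl

theorem q_int_mem_Ioo (j : Gap A A₀) (x : ℤ) :
    (q (mk (.inl (j, .int x)) : Z A A₀)) ∈
      Ioo (q (mk (.inl (j, .int (x - 1))) : Z A A₀))
        (q (mk (.inl (j, .int (x + 1))) : Z A A₀)) := by
  have hj : 0 < j.r - j.l := sub_pos.2 j.lt
  exact ⟨add_lt_add_right (mul_lt_mul_of_pos_left (Spiral.intPos_strictMono (by omega)) hj) _,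
    add_lt_add_right (mul_lt_mul_of_pos_left (Spiral.intPos_strictMono (by omega)) hj) _⟩

theorem q_zeta_injective : Function.Injective fun z : Z A A₀ => (q z, zeta z) := by
  intro z w h
  obtain ⟨hq, hζ⟩ := Prod.mk.inj h
  rcases normal_form w with ⟨a, t, rfl⟩ | ⟨j, x, rfl⟩
  · rcases normal_form z with ⟨b, s, rfl⟩ | ⟨i, y, rfl⟩
    · obtain rfl : b = a := Subtype.ext hq
      obtain rfl : s = t := hζ
      rfl
    · have := q_int_mem i y
      rw [hq] at this
      exact absurd a.2 (i.sub this).2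
  · exact eq_int_of_q_mem j x z (hq ▸ q_int_mem_Ioo j x)

theorem isEmbedding_q_zeta : IsEmbedding fun z : Z A A₀ => (q z, zeta z) :=
  ⟨⟨rfl⟩, q_zeta_injective⟩

theorem continuous_q : Continuous (q : Z A A₀ → ℝ) :=
  continuous_fst.comp isEmbedding_q_zeta.continuous

theorem continuous_zeta : Continuous (zeta : Z A A₀ → Theta) :=
  continuous_snd.comp isEmbedding_q_zeta.continuous

instance : TopologicalSpace.MetrizableSpace Theta :=
  have : ∀ m : ℕ+, SecondCountableTopology (ZMod m) := fun _ =>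
    DiscreteTopology.secondCountableTopology_of_countable
  have : SecondCountableTopology Theta :=
    TopologicalSpace.Subtype.secondCountableTopology _
  TopologicalSpace.metrizableSpace_of_t3_secondCountable _

instance : TopologicalSpace.MetrizableSpace (Z A A₀) := isEmbedding_q_zeta.metrizableSpace

theorem continuous_of_q_zeta (f : Z A A₀ → Z A A₀) (g : Theta → Theta) (hg : Continuous g)
    (hζ : ∀ z, zeta (f z) = g (zeta z))
    (hq : ∀ z, ∀ a ∈ A₀, |q (f z) - a| ≤ 2 * |q z - a|) : Continuous f := by
  refine continuous_induced_rng.2 (Continuous.prodMk ?_ ?_)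
  · refine continuous_iff_continuousAt.2 fun z => ?_
    rcases normal_form z with ⟨a, t, rfl⟩ | ⟨j, x, rfl⟩
    · have h0 : q (f (mk (.inr (a, t)))) = (a : ℝ) := by
        have h := hq (mk (.inr (a, t))) a a.2
        have e : q (mk (.inr (a, t)) : Z A A₀) = (a : ℝ) := rfl
        rw [e, sub_self, abs_zero, mul_zero] at h
        exact sub_eq_zero.1 (abs_nonpos_iff.1 h)
      refine tendsto_iff_dist_tendsto_zero.2 ?_
      have hlim : Filter.Tendsto (fun z : Z A A₀ => 2 * |q z - a|)
          (𝓝 (mk (.inr (a, t)))) (𝓝 0) := by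
        have hc : Continuous fun z : Z A A₀ => 2 * |q z - a| :=
          continuous_const.mul (continuous_q.sub continuous_const).abs
        have h := hc.tendsto (mk (.inr (a, t)))
        have e : q (mk (.inr (a, t)) : Z A A₀) = (a : ℝ) := rfl
        rwa [e, sub_self, abs_zero, mul_zero] at h
      refine squeeze_zero (fun _ => dist_nonneg) (fun z => ?_) hlim
      change dist (q (f z)) (q (f (mk (.inr (a, t))))) ≤ _
      rw [h0]
      exact hq z a a.2
    · have hn : {(mk (.inl (j, .int x)) : Z A A₀)} ∈
          𝓝 (mk (.inl (j, .int x)) : Z A A₀) :=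
        Filter.mem_of_superset
          ((isOpen_Ioo.preimage continuous_q).mem_nhds (q_int_mem_Ioo j x))
          fun z hz => eq_int_of_q_mem j x z hz
      have hp : 𝓝 (mk (.inl (j, .int x)) : Z A A₀) = pure _ :=
        le_antisymm (Filter.le_pure_iff.2 hn) (pure_le_nhds _)
      unfold ContinuousAt
      rw [hp]
      exact tendsto_pure_nhds _ _
  · exact (hg.comp continuous_zeta).congr fun z => (hζ z).symm

theorem abs_q_sub_le (j : Gap A A₀) (p p' : Spiral Theta)
    (h : |p'.pos - p.pos| ≤ min p.pos (1 - p.pos)) (a : ℝ) (ha : a ∈ A₀) :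
    |q (mk (.inl (j, p')) : Z A A₀) - a| ≤
      2 * |q (mk (.inl (j, p)) : Z A A₀) - a| := by
  change |j.l + (j.r - j.l) * p'.pos - a| ≤ 2 * |j.l + (j.r - j.l) * p.pos - a|
  have hj : 0 < j.r - j.l := sub_pos.2 j.lt
  have h1 := mul_le_mul_of_nonneg_left (h.trans (min_le_left _ _)) hj.le
  have h2 := mul_le_mul_of_nonneg_left (h.trans (min_le_right _ _)) hj.le
  rw [← abs_of_pos hj, ← abs_mul, abs_of_pos hj] at h1 h2
  obtain ⟨h1a, h1b⟩ := abs_le.1 h1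
  obtain ⟨h2a, h2b⟩ := abs_le.1 h2
  have hj' : a ≤ j.l ∨ j.r ≤ a := by
    by_contra hc
    push Not at hc
    exact (j.sub ⟨hc.1, hc.2⟩).2 ha
  rcases hj' with hj' | hj'
  · rw [abs_of_nonneg (a := j.l + (j.r - j.l) * p.pos - a) (by nlinarith)]
    rw [abs_le]; constructor <;> nlinarith
  · rw [abs_of_nonpos (a := j.l + (j.r - j.l) * p.pos - a) (by nlinarith)]
    rw [abs_le]; constructor <;> nlinarith

/-- The homeomorphism `τ` of `Z(A, A₀)`. -/
def shift (A A₀ : Set ℝ) : Z A A₀ ≃ₜ Z A A₀ where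
  toEquiv := shiftEquiv A A₀
  continuous_toFun := by
    refine continuous_of_q_zeta _ (fun t => t + 1) (continuous_id.add continuous_const) ?_ ?_
    · rintro ⟨⟨j, t | x | t⟩ | ⟨a, t⟩⟩
      · rfl
      · exact (by push_cast; rfl : ((x + 1 : ℤ) : Theta) = (x : Theta) + 1)
      · rfl
      · rfl
    · rintro ⟨⟨j, p⟩ | ⟨b, t⟩⟩ a ha
      · exact abs_q_sub_le j _ _ (Spiral.abs_pos_shift_sub_le p) a ha
      · exact le_mul_of_one_le_left (abs_nonneg _) one_le_two
  continuous_invFun := by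
    refine continuous_of_q_zeta _ (fun t => t - 1) (continuous_id.sub continuous_const) ?_ ?_
    · rintro ⟨⟨j, t | x | t⟩ | ⟨a, t⟩⟩
      · rfl
      · exact (by push_cast; rfl : ((x - 1 : ℤ) : Theta) = (x : Theta) - 1)
      · rfl
      · rfl
    · rintro ⟨⟨j, p⟩ | ⟨b, t⟩⟩ a ha
      · exact abs_q_sub_le j _ _ (Spiral.abs_pos_shift_symm_sub_le p) a ha
      · exact le_mul_of_one_le_left (abs_nonneg _) one_le_two

end Z

/-! ### The Special Homeomorphism -/

/-- The Cantor space `X(A, A₀) = Z(A, A₀) × C`, with `C` the classical Cantor set. -/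
abbrev X (A A₀ : Set ℝ) : Type := Z A A₀ × cantorSet

/-- The homeomorphism `T(A, A₀) = τ × 1_C` of `X(A, A₀)`. -/
def T (A A₀ : Set ℝ) : X A A₀ ≃ₜ X A A₀ := (Z.shift A A₀).prodCongr (Homeomorph.refl cantorSet)

/-- The set `D ⊆ [0, 1]` of the points with a ternary expansion `.a₀a₁a₂…` such that the smallest
index `i` with `aᵢ = 1`, if there is one, is even. Of the open middle thirds removed in the
construction of the Cantor set, it contains those of length `1/3, 1/27, …` and not those of length
`1/9, 1/81, …`. -/
def D : Set ℝ :=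
  {x | ∃ d : ℕ → Fin 3, Real.ofDigits d = x ∧
    ∀ i, d i = 1 → (∀ k < i, d k ≠ 1) → Even i}

end LiftingLemma
end

noncomputable section

namespace LiftingLemma

/-! ### Gaps and cuts of `D` near points of the Cantor set -/

/-! The theorem rests on a normal form for action maps on small invariant pieces. By compactness
there is a scale `N` at which `φ` is constant and no pair of points is at distance at least `ε`
(`exists_close_notMem`). Near every point of `C` there are gaps of `D` as well as cuts, points that
lie neither in `C` nor in a gap. Finitely many cuts divide `Z` into clopen invariant pieces, each
containing the spiral of a gap `J i` and only points within `δ` of that gap (`exists_partition`).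
The product with the sets of fixed first `N` Cantor digits gives finitely many pieces `P`.

On the spiral of `J i` the map `φ` traces a walk in a finite spiral. A walk either stays in one of
the two end cycles or runs through the whole spiral once (`FinSpiral.exists_walk_eq`), so it is a
translate collapsed according to a kind `L`, `R` or `M`. The rest of the piece is close to the two
ends of this spiral, so `φ` equals on all of `P` a word `ω` together with the collapse of kind `K`
of the translated retraction to the spiral (`eq_of_orbit_eq`). Every type `(ω, K)` occurs: some
orbit passes through the middle of the spiral of `ω`, and gaps close to its two ends have kinds `L`
and `R` (`IsActionMap.exists_gaps`).

The composed projection from the spiral of a word `u` of length `n + k` is itself a collapse, of a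
kind read off from `u` (`W.xiIter_ofSpiral`). The indices 1 and 2 of the letters provide at least `2
^ k` words over each type, so for large `k` the words can be mapped onto the pieces respecting types
(`exists_word_map`). The later Cantor digits split each piece into one part for each of its words
`u`, and `ρ` sends the part of `u` to the spiral of `u` by the translated retraction. Then `ξ ∘ ρ =
φ` by the choice of types. The fibers of `ρ` are small because, for large `k`, a fiber in a piece is
a single wandering orbit point or stays close to one end of the gap, with fixed residue and digits.
-/

theorem ofDigits_cons (d : ℕ → Fin 3) :
    Real.ofDigits d = ((d 0 : ℕ) + Real.ofDigits fun i => d (i + 1)) / 3 := by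
  rw [Real.ofDigits_eq_sum_add_ofDigits d 1]
  simp [Real.ofDigitsTerm]
  ring

/-- The points with a ternary expansion in which the first digit `1`, if any, has index in `s`. -/
def ternarySet (s : Set ℕ) : Set ℝ :=
  {x | ∃ d : ℕ → Fin 3, Real.ofDigits d = x ∧ ∀ i, d i = 1 → (∀ k < i, d k ≠ 1) → i ∈ s}

theorem D_eq_ternarySet : D = ternarySet {i | Even i} := rfl

theorem zero_mem_ternarySet (s : Set ℕ) : (0 : ℝ) ∈ ternarySet s :=
  ⟨fun _ => 0, by simp [Real.ofDigits, Real.ofDigitsTerm], fun i h => by simp at h⟩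

theorem one_mem_ternarySet (s : Set ℕ) : (1 : ℝ) ∈ ternarySet s :=
  ⟨fun _ => Fin.last 2, Real.ofDigits_const_last_eq_one 2, fun i h => by simp [Fin.ext_iff] at h⟩

/-- Prefixing a digit 0 or 2 shifts all indices by one. An expansion of `(e + y) / 3` can begin with
a digit other than `e` only if `y` is 0 or 1, and these endpoints belong to every `ternarySet`. -/
theorem ternarySet_scale {s s' : Set ℕ} (hs : ∀ i, i + 1 ∈ s ↔ i ∈ s') {e y : ℝ}
    (he : e = 0 ∨ e = 2) (hy : y ∈ Icc (0 : ℝ) 1) :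
    (e + y) / 3 ∈ ternarySet s ↔ y ∈ ternarySet s' := by
  constructor
  · rintro ⟨d, hd, h⟩
    rw [ofDigits_cons] at hd
    have h0 := Real.ofDigits_nonneg fun i => d (i + 1)
    have h1 := Real.ofDigits_le_one fun i => d (i + 1)
    have hlast : y = 0 ∨ y = 1 ∨ (d 0 ≠ 1 ∧ Real.ofDigits (fun i => d (i + 1)) = y) := by
      have hd0 : d 0 = 0 ∨ d 0 = 1 ∨ d 0 = 2 := by
        generalize d 0 = a
        fin_cases a <;> simp
      rcases he with rfl | rfl <;> rcases hd0 with e0 | e0 | e0 <;> rw [e0] at hd ⊢ <;>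
        norm_num at hd
      · exact Or.inr (Or.inr ⟨by decide, by linarith⟩)
      · exact Or.inr (Or.inl (by linarith [hy.2]))
      · linarith [hy.2]
      · linarith [hy.1]
      · exact Or.inl (by linarith [hy.1])
      · exact Or.inr (Or.inr ⟨by decide, by linarith⟩)
    rcases hlast with rfl | rfl | ⟨hd0, hy'⟩
    · exact zero_mem_ternarySet _
    · exact one_mem_ternarySet _
    · refine ⟨_, hy', fun i hi hk => (hs i).1 (h _ hi fun k hk' => ?_)⟩
      rcases k with _ | k
      · exact hd0
      · exact hk k (by omega)
  · rintro ⟨d, rfl, h⟩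
    obtain ⟨a, ha, hae⟩ : ∃ a : Fin 3, a ≠ 1 ∧ ((a : ℕ) : ℝ) = e := by
      rcases he with rfl | rfl
      · exact ⟨0, by decide, by simp⟩
      · exact ⟨2, by decide, by simp⟩
    refine ⟨fun i => Nat.casesOn i a d, ?_, fun i hi hk => ?_⟩
    · rw [ofDigits_cons, ← hae]
      rfl
    · rcases i with _ | i
      · exact absurd hi ha
      · exact (hs i).2 (h i hi fun k hk' => hk (k + 1) (by omega))

/-- Two steps of the Cantor construction preserve the parity of the index of the first 1. The pair
`(D, C)` is therefore self-similar with ratio 1/9, whereas one step exchanges even and odd. -/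
theorem D_scale {e e' y : ℝ} (he : e = 0 ∨ e = 2) (he' : e' = 0 ∨ e' = 2)
    (hy : y ∈ Icc (0 : ℝ) 1) : (e + (e' + y) / 3) / 3 ∈ D ↔ y ∈ D := by
  have hy' : (e' + y) / 3 ∈ Icc (0 : ℝ) 1 := by
    rcases he' with rfl | rfl <;> constructor <;> linarith [hy.1, hy.2]
  rw [D_eq_ternarySet, ternarySet_scale (s' := {i | Odd i}) (fun i => ?_) he hy',
    ternarySet_scale (s' := {i | Even i}) (fun i => ?_) he' hy]
  · simp [Nat.odd_add_one]
  · simp [Nat.even_add_one]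

theorem cantorSet_scale {e y : ℝ} (he : e = 0 ∨ e = 2) (hy : y ∈ Icc (0 : ℝ) 1) :
    (e + y) / 3 ∈ cantorSet ↔ y ∈ cantorSet := by
  constructor
  · intro h
    rw [cantorSet_eq_union_halves] at h
    rcases h with ⟨x, hx, hxy⟩ | ⟨x, hx, hxy⟩ <;>
      have hx' := cantorSet_subset_unitInterval hx <;> simp only at hxy <;>
      rcases he with rfl | rfl
    · rwa [show y = x by linarith]
    · linarith [hx'.2, hy.1]
    · linarith [hx'.1, hy.2]
    · rwa [show y = x by linarith]
  · intro h
    rw [cantorSet_eq_union_halves]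
    rcases he with rfl | rfl
    · exact Or.inl ⟨y, h, by simp⟩
    · exact Or.inr ⟨y, h, rfl⟩

theorem exists_eq_scale {c : ℝ} (hc : c ∈ cantorSet) :
    ∃ e y : ℝ, (e = 0 ∨ e = 2) ∧ y ∈ cantorSet ∧ c = (e + y) / 3 := by
  rw [cantorSet_eq_union_halves] at hc
  rcases hc with ⟨x, hx, rfl⟩ | ⟨x, hx, rfl⟩
  · exact ⟨0, x, Or.inl rfl, hx, by simp⟩
  · exact ⟨2, x, Or.inr rfl, hx, rfl⟩

/-- Every point of the Cantor set is in arbitrarily small scaled copies of `(D, C)`. -/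
theorem exists_small_copy (m : ℕ) : ∀ c ∈ cantorSet, ∃ u : ℝ, 0 ≤ u ∧ u + 1 / 9 ^ m ≤ 1 ∧
    u ≤ c ∧ c ≤ u + 1 / 9 ^ m ∧ ∀ s ∈ Icc (0 : ℝ) 1,
      (u + s / 9 ^ m ∈ cantorSet ↔ s ∈ cantorSet) ∧ (u + s / 9 ^ m ∈ D ↔ s ∈ D) := by
  induction m with
  | zero =>
    intro c hc
    have := cantorSet_subset_unitInterval hc
    exact ⟨0, le_rfl, by norm_num, this.1, by simpa using this.2, fun s _ => by simp⟩
  | succ m ih =>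
    intro c hc
    obtain ⟨e, c', he, hc', rfl⟩ := exists_eq_scale hc
    obtain ⟨e', c'', he', hc'', rfl⟩ := exists_eq_scale hc'
    obtain ⟨u, h0, h1, h2, h3, h4⟩ := ih c'' hc''
    have key : ∀ s : ℝ, (e + (e' + u) / 3) / 3 + s / 9 ^ (m + 1) =
        (e + (e' + (u + s / 9 ^ m)) / 3) / 3 := fun s => by
      rw [pow_succ]
      field_simp
      ring
    refine ⟨(e + (e' + u) / 3) / 3, ?_, ?_, ?_, ?_, fun s hs => ?_⟩
    · rcases he with rfl | rfl <;> rcases he' with rfl | rfl <;> linarith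
    · rw [key]
      rcases he with rfl | rfl <;> rcases he' with rfl | rfl <;> linarith
    · linarith
    · rw [key]
      linarith
    · have hp : (0 : ℝ) < 9 ^ m := by positivity
      have hm : u + s / 9 ^ m ∈ Icc (0 : ℝ) 1 :=
        ⟨add_nonneg h0 (div_nonneg hs.1 hp.le),
          (add_le_add_right (div_le_div_of_nonneg_right hs.2 hp.le) u).trans h1⟩
      have hm' : (e' + (u + s / 9 ^ m)) / 3 ∈ Icc (0 : ℝ) 1 := by
        rcases he' with rfl | rfl <;> constructor <;> linarith [hm.1, hm.2]
      rw [key, D_scale he he' hm, cantorSet_scale he hm', cantorSet_scale he' hm]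
      exact h4 s hs

theorem notMem_cantorSet_of_middle {s : ℝ} (h : s ∈ Ioo (1 / 3 : ℝ) (2 / 3)) :
    s ∉ cantorSet := by
  intro hs
  obtain ⟨e, y, he, hy, rfl⟩ := exists_eq_scale hs
  have hy' := cantorSet_subset_unitInterval hy
  rcases he with rfl | rfl
  · linarith [h.1, hy'.2]
  · linarith [h.2, hy'.1]

theorem one_mem_cantorSet : (1 : ℝ) ∈ cantorSet := by
  rw [← Real.ofDigits_const_last_eq_one 2]
  exact ofDigits_zero_two_sequence_mem_cantorSet fun _ => by simp [Fin.ext_iff]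

theorem mem_D_of_middle {s : ℝ} (h : s ∈ Icc (1 / 3 : ℝ) (2 / 3)) : s ∈ D := by
  obtain ⟨d, -, hd⟩ := Real.ofDigits_SurjOn (b := 3) (by norm_num)
    (⟨by linarith [h.1], by linarith [h.2]⟩ : 3 * s - 1 ∈ Icc (0 : ℝ) 1)
  refine ⟨fun i => Nat.casesOn i 1 d, ?_, fun i hi hk => ?_⟩
  · rw [ofDigits_cons]
    simp [hd]
  · rcases i with _ | i
    · exact Even.zero
    · exact absurd rfl (hk 0 (by omega))

theorem sixth_notMem_D : (1 / 6 : ℝ) ∉ D := by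
  have h : (1 / 6 : ℝ) = (0 + 1 / 2) / 3 := by norm_num
  rw [h, D_eq_ternarySet, ternarySet_scale (s' := {i | Odd i}) (fun i => by
    simp [Nat.even_add_one]) (Or.inl rfl) (by norm_num)]
  rintro ⟨d, hd, hi⟩
  rw [ofDigits_cons] at hd
  have h0 := Real.ofDigits_nonneg fun i => d (i + 1)
  have h1 := Real.ofDigits_le_one fun i => d (i + 1)
  have hd0 : d 0 = 0 ∨ d 0 = 1 ∨ d 0 = 2 := by
    generalize d 0 = a
    fin_cases a <;> simp
  rcases hd0 with e0 | e0 | e0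
  · norm_num [e0] at hd
    linarith
  · have := hi 0 e0 (by simp)
    simp at this
  · norm_num [e0] at hd
    linarith

theorem sixth_notMem_cantorSet : (1 / 6 : ℝ) ∉ cantorSet := by
  have h : (1 / 6 : ℝ) = (0 + 1 / 2) / 3 := by norm_num
  rw [h, cantorSet_scale (Or.inl rfl) (by norm_num)]
  exact notMem_cantorSet_of_middle (by norm_num)

/-- The middle third of a small copy of `(D, C)` around `c` is a gap, since its digit 1 has the even
index 0 in the copy. -/
theorem exists_gap_near {c : ℝ} (hc : c ∈ cantorSet) {δ : ℝ} (hδ : 0 < δ) :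
    ∃ j : Gap D cantorSet, |j.l - c| < δ ∧ |j.r - c| < δ := by
  obtain ⟨m, hm⟩ := exists_pow_lt_of_lt_one hδ (by norm_num : (1 / 9 : ℝ) < 1)
  rw [one_div_pow] at hm
  obtain ⟨u, -, -, h2, h3, h4⟩ := exists_small_copy m c hc
  have hp : (0 : ℝ) < 9 ^ m := by positivity
  have e1 : (1 : ℝ) / 3 / 9 ^ m = (1 / 9 ^ m) / 3 := by ring
  have e2 : (2 : ℝ) / 3 / 9 ^ m = 2 * (1 / 9 ^ m) / 3 := by ring
  have hp' : (0 : ℝ) < 1 / 9 ^ m := by positivity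
  refine ⟨⟨u + 1 / 3 / 9 ^ m, u + 2 / 3 / 9 ^ m, by linarith,
    (h4 _ (by norm_num)).1.2 ?_, (h4 _ (by norm_num)).1.2 ?_, fun y hy => ?_⟩, ?_, ?_⟩
  · rw [show (1 / 3 : ℝ) = (0 + 1) / 3 by norm_num, cantorSet_scale (Or.inl rfl) (by norm_num)]
    exact one_mem_cantorSet
  · rw [show (2 / 3 : ℝ) = (2 + 0) / 3 by norm_num, cantorSet_scale (Or.inr rfl) (by norm_num)]
    exact zero_mem_cantorSet
  · obtain ⟨s, rfl⟩ : ∃ s, y = u + s / 9 ^ m := ⟨(y - u) * 9 ^ m, by field_simp; ring⟩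
    have hs1 : 1 / 3 < s := (div_lt_div_iff_of_pos_right hp).1 (by linarith [hy.1])
    have hs2 : s < 2 / 3 := (div_lt_div_iff_of_pos_right hp).1 (by linarith [hy.2])
    have hs : s ∈ Icc (0 : ℝ) 1 := ⟨by linarith, by linarith⟩
    exact ⟨(h4 s hs).2.2 (mem_D_of_middle ⟨hs1.le, hs2.le⟩),
      fun h => notMem_cantorSet_of_middle ⟨hs1, hs2⟩ ((h4 s hs).1.1 h)⟩
  · simp only [abs_lt]
    constructor <;> linarith
  · simp only [abs_lt]
    constructor <;> linarith

/-- A cut is a point that is neither in the Cantor set nor in one of the gaps of `D`. -/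
def IsCut (f : ℝ) : Prop := f ∉ cantorSet ∧ ∀ j : Gap D cantorSet, f ∉ Ioo j.l j.r

/-- In the copy of `(D, C)`, the point 1/6 is the center of the removed interval `(1/9, 2/9)`, which
`D` omits. -/
theorem exists_cut_near {c : ℝ} (hc : c ∈ cantorSet) {δ : ℝ} (hδ : 0 < δ) :
    ∃ f, IsCut f ∧ |f - c| < δ := by
  obtain ⟨m, hm⟩ := exists_pow_lt_of_lt_one hδ (by norm_num : (1 / 9 : ℝ) < 1)
  rw [one_div_pow] at hm
  obtain ⟨u, -, -, h2, h3, h4⟩ := exists_small_copy m c hc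
  have e1 : (1 : ℝ) / 6 / 9 ^ m = (1 / 9 ^ m) / 6 := by ring
  have hp' : (0 : ℝ) < 1 / 9 ^ m := by positivity
  have h6 := h4 (1 / 6) (by norm_num)
  refine ⟨u + 1 / 6 / 9 ^ m, ⟨fun h => sixth_notMem_cantorSet (h6.1.1 h),
    fun j hj => sixth_notMem_D (h6.2.1 (j.sub hj).1)⟩, ?_⟩
  rw [abs_lt]
  constructor <;> linarith

/-! ### Order relations between gaps, cuts and points of the Cantor set -/

theorem Gap.eq_of_mem {A A₀ : Set ℝ} {i j : Gap A A₀} {x : ℝ} (hi : x ∈ Ioo i.l i.r)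
    (hj : x ∈ Ioo j.l j.r) : i = j := by
  have h1 := fun h => (i.sub h).2 j.l_mem
  have h2 := fun h => (i.sub h).2 j.r_mem
  have h3 := fun h => (j.sub h).2 i.l_mem
  have h4 := fun h => (j.sub h).2 i.r_mem
  have hl : i.l = j.l := by
    rcases lt_trichotomy i.l j.l with h | h | h
    · exact (h1 ⟨h, hj.1.trans hi.2⟩).elim
    · exact h
    · exact (h3 ⟨h, hi.1.trans hj.2⟩).elim
  have hr : i.r = j.r := by
    rcases lt_trichotomy i.r j.r with h | h | h
    · exact (h4 ⟨hj.1.trans hi.2, h⟩).elim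
    · exact h
    · exact (h2 ⟨hi.1.trans hj.2, h⟩).elim
  cases i; cases j; cases hl; cases hr; rfl

theorem Gap.le_or_le {A A₀ : Set ℝ} (j : Gap A A₀) {a : ℝ} (ha : a ∈ A₀) : a ≤ j.l ∨ j.r ≤ a := by
  by_contra! h
  exact (j.sub h).2 ha

theorem Gap.le_or_le_of_isCut (j : Gap D cantorSet) {f : ℝ} (hf : IsCut f) :
    f < j.l ∨ j.r < f := by
  have h1 : f ≠ j.l := fun h => hf.1 (h ▸ j.l_mem)
  have h2 : f ≠ j.r := fun h => hf.1 (h ▸ j.r_mem)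
  rcases h1.lt_or_gt with h | h
  · exact Or.inl h
  · rcases h2.lt_or_gt with h' | h'
    · exact (hf.2 j ⟨h, h'⟩).elim
    · exact Or.inr h'

theorem Gap.le_or_le_of_ne {A A₀ : Set ℝ} {i j : Gap A A₀} (h : i ≠ j) :
    i.r ≤ j.l ∨ j.r ≤ i.l := by
  rcases j.le_or_le i.l_mem with h1 | h1
  · rcases j.le_or_le i.r_mem with h2 | h2
    · exact Or.inl h2
    · have := j.lt
      exact (h (Gap.eq_of_mem (x := (j.l + j.r) / 2) ⟨by linarith, by linarith⟩
        ⟨by linarith, by linarith⟩)).elim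
  · exact Or.inr h1

/-- The left end of a gap is a limit from the left of other points of the Cantor set. -/
theorem Gap.exists_mem_left (j : Gap D cantorSet) {δ : ℝ} (hδ : 0 < δ) :
    ∃ c ∈ cantorSet, c ∈ Ioo (j.l - δ) j.l := by
  obtain ⟨i, h1, h2⟩ := exists_gap_near j.l_mem (lt_min hδ (sub_pos.2 j.lt))
  rw [lt_min_iff] at h1 h2
  have hi := i.lt
  refine ⟨i.l, i.l_mem, by linarith [(abs_lt.1 h1.1).1], ?_⟩
  rcases j.le_or_le i.r_mem with h | h
  · linarith
  · linarith [(abs_lt.1 h2.2).2]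

theorem Gap.exists_mem_right (j : Gap D cantorSet) {δ : ℝ} (hδ : 0 < δ) :
    ∃ c ∈ cantorSet, c ∈ Ioo j.r (j.r + δ) := by
  obtain ⟨i, h1, h2⟩ := exists_gap_near j.r_mem (lt_min hδ (sub_pos.2 j.lt))
  rw [lt_min_iff] at h1 h2
  have hi := i.lt
  refine ⟨i.r, i.r_mem, ?_, by linarith [(abs_lt.1 h2.1).2]⟩
  rcases j.le_or_le i.l_mem with h | h
  · linarith [(abs_lt.1 h1.2).1]
  · linarith

theorem exists_cut_Ioo {c a b : ℝ} (hc : c ∈ cantorSet) (h : c ∈ Ioo a b) :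
    ∃ f, IsCut f ∧ f ∈ Ioo a b := by
  obtain ⟨f, hf, hfc⟩ := exists_cut_near hc (lt_min (sub_pos.2 h.1) (sub_pos.2 h.2))
  rw [lt_min_iff] at hfc
  exact ⟨f, hf, by linarith [(abs_lt.1 hfc.1).1], by linarith [(abs_lt.1 hfc.2).2]⟩

theorem exists_gap_Ioo {c a b : ℝ} (hc : c ∈ cantorSet) (h : c ∈ Ioo a b) :
    ∃ j : Gap D cantorSet, a < j.l ∧ j.r < b := by
  obtain ⟨j, h1, h2⟩ := exists_gap_near hc (lt_min (sub_pos.2 h.1) (sub_pos.2 h.2))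
  rw [lt_min_iff] at h1 h2
  exact ⟨j, by linarith [(abs_lt.1 h1.1).1], by linarith [(abs_lt.1 h2.2).2]⟩

theorem Gap.exists_cut_left (j : Gap D cantorSet) {δ : ℝ} (hδ : 0 < δ) :
    ∃ f, IsCut f ∧ f ∈ Ioo (j.l - δ) j.l :=
  let ⟨_, hc, h⟩ := j.exists_mem_left hδ
  exists_cut_Ioo hc h

theorem Gap.exists_cut_right (j : Gap D cantorSet) {δ : ℝ} (hδ : 0 < δ) :
    ∃ f, IsCut f ∧ f ∈ Ioo j.r (j.r + δ) :=
  let ⟨_, hc, h⟩ := j.exists_mem_right hδ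
  exists_cut_Ioo hc h

/-- If no point of `C` is just to the left of `r`, then `r - δ / 2` is itself a cut: a gap around it
would have to end at `r`. -/
theorem exists_cut_left {r : ℝ} (hr : r ∈ cantorSet) (hj : ∀ j : Gap D cantorSet, r ≠ j.r)
    {δ : ℝ} (hδ : 0 < δ) : ∃ f, IsCut f ∧ f ∈ Ioo (r - δ) r := by
  by_cases h : ∃ c ∈ cantorSet, c ∈ Ioo (r - δ) r
  · obtain ⟨c, hc, h⟩ := h
    exact exists_cut_Ioo hc h
  · refine ⟨r - δ / 2, ⟨fun hc => h ⟨_, hc, by constructor <;> linarith⟩, fun j hm => ?_⟩,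
      by constructor <;> linarith⟩
    rcases j.le_or_le hr with h1 | h1
    · linarith [hm.1]
    · exact h ⟨j.r, j.r_mem, by linarith [hm.2], lt_of_le_of_ne h1 (hj j).symm⟩

theorem exists_cut_right {r : ℝ} (hr : r ∈ cantorSet) (hj : ∀ j : Gap D cantorSet, r ≠ j.l)
    {δ : ℝ} (hδ : 0 < δ) : ∃ f, IsCut f ∧ f ∈ Ioo r (r + δ) := by
  by_cases h : ∃ c ∈ cantorSet, c ∈ Ioo r (r + δ)
  · obtain ⟨c, hc, h⟩ := h
    exact exists_cut_Ioo hc h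
  · refine ⟨r + δ / 2, ⟨fun hc => h ⟨_, hc, by constructor <;> linarith⟩, fun j hm => ?_⟩,
      by constructor <;> linarith⟩
    rcases j.le_or_le hr with h1 | h1
    · exact h ⟨j.l, j.l_mem, lt_of_le_of_ne h1 (hj j), by linarith [hm.1]⟩
    · linarith [hm.2]

/-- A gap and a pair of cuts closely around it. -/
theorem exists_cuts_around {r : ℝ} (hr : r ∈ cantorSet ∨ ∃ j : Gap D cantorSet, r ∈ Ioo j.l j.r)
    {δ : ℝ} (hδ : 0 < δ) : ∃ a b, ∃ j : Gap D cantorSet, IsCut a ∧ IsCut b ∧ a < r ∧ r < b ∧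
      j.l - δ < a ∧ a < j.l ∧ j.r < b ∧ b < j.r + δ := by
  by_cases h : ∃ j : Gap D cantorSet, r ∈ Icc j.l j.r
  · obtain ⟨j, hj⟩ := h
    obtain ⟨a, ha, ha'⟩ := j.exists_cut_left hδ
    obtain ⟨b, hb, hb'⟩ := j.exists_cut_right hδ
    exact ⟨a, b, j, ha, hb, ha'.2.trans_le hj.1, hj.2.trans_lt hb'.1, ha'.1, ha'.2, hb'.1, hb'.2⟩
  · push Not at h
    have hrC : r ∈ cantorSet := hr.resolve_right fun ⟨j, hj⟩ => h j ⟨hj.1.le, hj.2.le⟩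
    obtain ⟨a, ha, ha'⟩ := exists_cut_left hrC
      (fun j e => h j ⟨e ▸ j.lt.le, e.le⟩) (half_pos hδ)
    obtain ⟨b, hb, hb'⟩ := exists_cut_right hrC
      (fun j e => h j ⟨e.ge, e ▸ j.lt.le⟩) (half_pos hδ)
    obtain ⟨j, h1, h2⟩ := exists_gap_Ioo hrC ⟨ha'.2, hb'.1⟩
    have := j.lt
    exact ⟨a, b, j, ha, hb, ha'.2, hb'.1, by linarith [ha'.1, hb'.2], h1, h2,
      by linarith [ha'.1, hb'.2]⟩

/-! ### The profinite integers modulo factorials -/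

namespace Theta

theorem isClosed : IsClosed (Theta : Set (∀ m : ℕ+, ZMod m)) := by
  have h : (Theta : Set (∀ m : ℕ+, ZMod m)) =
      ⋂ (m : ℕ+) (n : ℕ+) (h : (m : ℕ) ∣ (n : ℕ)),
        {f | ZMod.castHom h (ZMod m) (f n) = f m} := by
    ext f
    simp only [mem_iInter]
    rfl
  rw [h]
  exact isClosed_iInter fun m => isClosed_iInter fun n => isClosed_iInter fun h =>
    isClosed_eq (continuous_of_discreteTopology.comp (continuous_apply n)) (continuous_apply m)

instance : CompactSpace Theta := isCompact_iff_compactSpace.1 isClosed.isCompact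

/-- Reduction modulo `n!`. -/
def red (n : ℕ) : Theta →+* ZMod n.factorial :=
  (Pi.evalRingHom (fun m : ℕ+ => ZMod m) ⟨n.factorial, n.factorial_pos⟩).comp Theta.subtype

theorem continuous_red (n : ℕ) : Continuous (red n) :=
  (continuous_apply (A := fun m : ℕ+ => ZMod m) ⟨n.factorial, n.factorial_pos⟩).comp
    continuous_subtype_val

theorem castHom_red {n m : ℕ} (h : n ≤ m) (t : Theta) :
    ZMod.castHom (Nat.factorial_dvd_factorial h) (ZMod n.factorial) (red m t) = red n t :=
  t.2 ⟨n.factorial, n.factorial_pos⟩ ⟨m.factorial, m.factorial_pos⟩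
    (Nat.factorial_dvd_factorial h)

theorem red_eq_of_le {n m : ℕ} (h : n ≤ m) {s t : Theta} (e : red m s = red m t) :
    red n s = red n t := by
  rw [← castHom_red h s, e, castHom_red h t]

/-- Factorials are cofinal for divisibility, since `m` divides `m!`. -/
theorem eq_of_red_eq {s t : Theta} (h : ∀ n, red n s = red n t) : s = t := by
  refine Subtype.ext (funext fun m => ?_)
  have hd : (m : ℕ) ∣ (m : ℕ).factorial := Nat.dvd_factorial m.pos le_rfl
  have hs := s.2 m ⟨(m : ℕ).factorial, Nat.factorial_pos _⟩ hd
  have ht := t.2 m ⟨(m : ℕ).factorial, Nat.factorial_pos _⟩ hd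
  rw [← hs, ← ht]
  exact congrArg _ (h m)

theorem exists_int_le (n : ℕ) (t : ZMod n.factorial) (B : ℤ) :
    ∃ x : ℤ, x ≤ B ∧ (x : ZMod n.factorial) = t := by
  obtain ⟨v, rfl⟩ := ZMod.intCast_surjective t
  -- As `n!` is at least 1, this witness is at most `v - |v| - |B|`, hence at most `B`.
  refine ⟨v - n.factorial * (|v| + |B|), ?_, by simp⟩
  have h1 : (1 : ℤ) ≤ n.factorial := by exact_mod_cast n.factorial_pos
  nlinarith [le_abs_self v, neg_abs_le B, abs_nonneg v, abs_nonneg B]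

theorem exists_int_ge (n : ℕ) (t : ZMod n.factorial) (B : ℤ) :
    ∃ x : ℤ, B ≤ x ∧ (x : ZMod n.factorial) = t := by
  obtain ⟨x, hx, hx'⟩ := exists_int_le n (-t) (-B)
  exact ⟨-x, by omega, by simp [hx']⟩

theorem red_surjective (n : ℕ) : Function.Surjective (red n) := fun t =>
  let ⟨x, hx⟩ := ZMod.intCast_surjective t
  ⟨x, by rw [map_intCast, hx]⟩

end Theta

/-! ### Compactness of the space of spirals -/

theorem Spiral.exists_intPos_lt {η : ℝ} (hη : 0 < η) :
    ∃ B : ℕ, ∀ x : ℤ, (x ≤ -B → intPos x < η) ∧ ((B : ℤ) ≤ x → 1 - η < intPos x) := by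
  obtain ⟨B, hB'⟩ := exists_nat_gt (1 / η)
  rw [div_lt_iff₀ hη] at hB'
  have key : ∀ x : ℤ, (B : ℤ) ≤ x → 1 - η < intPos x := fun x hx => by
    have hx0 : (0 : ℤ) ≤ x := by omega
    have hx1 : (B : ℝ) ≤ x := by exact_mod_cast hx
    have hB0 : (0 : ℝ) ≤ B := by positivity
    rw [intPos_of_nonneg x hx0, sub_lt_sub_iff_left, div_lt_iff₀ (by positivity)]
    nlinarith
  refine ⟨B, fun x => ⟨fun hx => ?_, key x⟩⟩
  have h := key (-x) (by omega)
  rw [intPos_neg] at h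
  linarith

/-- The points of the spiral of the gap `j`. -/
def Gap.pt {A A₀ : Set ℝ} (j : Gap A A₀) (p : Spiral Theta) : Z A A₀ := Z.mk (.inl (j, p))

/-- The points of the adding machine of `a`. -/
def Z.machine {A A₀ : Set ℝ} (a : A₀) (t : Theta) : Z A A₀ := Z.mk (.inr (a, t))

section

variable {A A₀ : Set ℝ}

theorem Gap.q_pt (j : Gap A A₀) (p : Spiral Theta) :
    Z.q (j.pt p) = j.l + (j.r - j.l) * p.pos := rfl

theorem Gap.q_negInf (j : Gap A A₀) (t : Theta) : Z.q (j.pt (.negInf t)) = j.l := by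
  simp [q_pt, Spiral.pos]

theorem Gap.q_posInf (j : Gap A A₀) (t : Theta) : Z.q (j.pt (.posInf t)) = j.r := by
  simp [q_pt, Spiral.pos]

theorem Gap.zeta_pt (j : Gap A A₀) (p : Spiral Theta) : Z.zeta (j.pt p) = p.zeta := rfl

theorem Gap.shift_pt (j : Gap A A₀) (p : Spiral Theta) :
    Z.shift A A₀ (j.pt p) = j.pt p.shift := rfl

theorem Z.shift_machine (a : A₀) (t : Theta) :
    Z.shift A A₀ (machine a t) = machine a (t + 1) := rfl

theorem Z.q_machine (a : A₀) (t : Theta) : q (machine a t : Z A A₀) = a := rfl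

theorem Gap.q_int_mem (j : Gap A A₀) (x : ℤ) : Z.q (j.pt (.int x)) ∈ Ioo j.l j.r :=
  Z.q_int_mem j x

theorem Z.eq_machine_or_eq_pt (z : Z A A₀) :
    (∃ a t, z = machine a t) ∨ ∃ (j : Gap A A₀) (x : ℤ), z = j.pt (.int x) :=
  normal_form z

theorem Gap.eq_pt_of_q_mem (j : Gap A A₀) {z : Z A A₀} (h : Z.q z ∈ Ioo j.l j.r) :
    ∃ x : ℤ, z = j.pt (.int x) := by
  rcases z.eq_machine_or_eq_pt with ⟨a, t, rfl⟩ | ⟨i, x, rfl⟩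
  · exact absurd a.2 (j.sub h).2
  · obtain rfl := Gap.eq_of_mem (i.q_int_mem x) h
    exact ⟨x, rfl⟩

theorem Gap.q_int_strictMono (j : Gap A A₀) : StrictMono fun x : ℤ => Z.q (j.pt (.int x)) :=
  fun _ _ h => add_lt_add_right
    (mul_lt_mul_of_pos_left (Spiral.intPos_strictMono h) (sub_pos.2 j.lt)) _

theorem Gap.exists_q_near (j : Gap A A₀) {η : ℝ} (hη : 0 < η) :
    ∃ B : ℕ, ∀ x : ℤ, (x ≤ -B → Z.q (j.pt (.int x)) < j.l + η) ∧
      ((B : ℤ) ≤ x → j.r - η < Z.q (j.pt (.int x))) := by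
  have hj := sub_pos.2 j.lt
  obtain ⟨B, hB⟩ := Spiral.exists_intPos_lt (div_pos hη hj)
  refine ⟨B, fun x => ⟨fun hx => ?_, fun hx => ?_⟩⟩
  · have h := (lt_div_iff₀ hj).1 ((hB x).1 hx)
    rw [q_pt]
    change j.l + (j.r - j.l) * Spiral.intPos x < _
    linarith
  · have h := (lt_div_iff₀ hj).1 (sub_lt_comm.1 ((hB x).2 hx))
    rw [q_pt]
    change _ < j.l + (j.r - j.l) * Spiral.intPos x
    linarith

theorem Gap.finite_q_mem_Icc (j : Gap A A₀) {a b : ℝ} (ha : j.l < a) (hb : b < j.r) :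
    {x : ℤ | Z.q (j.pt (.int x)) ∈ Icc a b}.Finite := by
  obtain ⟨B, hB⟩ := j.exists_q_near (lt_min (sub_pos.2 ha) (sub_pos.2 hb))
  refine (finite_Icc (-(B : ℤ)) B).subset fun x hx => ⟨?_, ?_⟩
  · by_contra! h
    linarith [(hB x).1 h.le, hx.1, min_le_left (a - j.l) (j.r - b)]
  · by_contra! h
    linarith [(hB x).2 h.le, hx.2, min_le_right (a - j.l) (j.r - b)]

/-- Over `A₀` the range contains the full fiber `Θ`. Away from `A₀`, the values close to a limit `r`
come from the wandering orbit of a single gap, which has only finitely many points near `r`; a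
finite set is closed. -/
theorem isClosed_range_q_zeta (h₀ : IsClosed A₀) :
    IsClosed (range fun z : Z A A₀ => (Z.q z, Z.zeta z)) := by
  refine isClosed_of_closure_subset fun ⟨r, t⟩ hrt => ?_
  by_cases hr : r ∈ A₀
  · exact ⟨Z.machine ⟨r, hr⟩ t, rfl⟩
  obtain ⟨η, hη, hball⟩ := Metric.isOpen_iff.1 h₀.isOpen_compl r hr
  have hnear : ∀ z : Z A A₀, |Z.q z - r| < η → ∃ (j : Gap A A₀) (x : ℤ), z = j.pt (.int x) ∧
      j.l ≤ r - η ∧ r + η ≤ j.r := fun z hz => by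
    rcases z.eq_machine_or_eq_pt with ⟨a, t, rfl⟩ | ⟨j, x, rfl⟩
    · exact (hball hz a.2).elim
    · have hx := j.q_int_mem x
      rw [abs_lt] at hz
      refine ⟨j, x, rfl, ?_, ?_⟩
      · by_contra! h
        exact hball (a := j.l) (by
          rw [Metric.mem_ball, Real.dist_eq, abs_lt]
          constructor <;> linarith [hx.1]) j.l_mem
      · by_contra! h
        exact hball (a := j.r) (by
          rw [Metric.mem_ball, Real.dist_eq, abs_lt]
          constructor <;> linarith [hx.2]) j.r_mem
  have hV : (fun p : ℝ × Theta => p.1) ⁻¹' Ioo (r - η / 2) (r + η / 2) ∈ 𝓝 (r, t) :=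
    continuous_fst.continuousAt.preimage_mem_nhds (Ioo_mem_nhds (by linarith) (by linarith))
  have hcl := mem_closure_iff_nhds.1 hrt
  obtain ⟨_, hz, z, rfl⟩ := hcl _ hV
  obtain ⟨j, x, rfl, hl, hr'⟩ := hnear z (abs_lt.2 ⟨by linarith [hz.1], by linarith [hz.2]⟩)
  have hfin := (j.finite_q_mem_Icc (a := r - η / 2) (b := r + η / 2)
    (by linarith) (by linarith)).image
    fun x => (Z.q (j.pt (.int x)), Z.zeta (j.pt (.int x)))
  have hmem : (r, t) ∈ closure ((fun x : ℤ => (Z.q (j.pt (.int x)), Z.zeta (j.pt (.int x)))) ''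
      {x : ℤ | Z.q (j.pt (.int x)) ∈ Icc (r - η / 2) (r + η / 2)}) := by
    refine mem_closure_iff_nhds.2 fun U hU => ?_
    obtain ⟨_, ⟨hz1, hz2⟩, z, rfl⟩ := hcl _ (Filter.inter_mem hU hV)
    obtain ⟨y, rfl⟩ := j.eq_pt_of_q_mem (z := z)
      ⟨by linarith [hz2.1], by linarith [hz2.2]⟩
    exact ⟨_, hz1, y, ⟨hz2.1.le, hz2.2.le⟩, rfl⟩
  rw [hfin.isClosed.closure_eq] at hmem
  obtain ⟨y, -, hy⟩ := hmem
  exact ⟨_, hy⟩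

theorem Z.q_mem_Icc (h₀ : A₀ ⊆ Icc 0 1) (z : Z A A₀) : q z ∈ Icc (0 : ℝ) 1 := by
  rcases z.eq_machine_or_eq_pt with ⟨a, t, rfl⟩ | ⟨j, x, rfl⟩
  · exact h₀ a.2
  · have h := j.q_int_mem x
    exact ⟨(h₀ j.l_mem).1.trans h.1.le, h.2.le.trans (h₀ j.r_mem).2⟩

instance : CompactSpace (Z D cantorSet) := by
  refine ⟨Z.isEmbedding_q_zeta.isCompact_iff.2 ?_⟩
  rw [image_univ]
  refine ((isCompact_Icc (a := (0 : ℝ)) (b := 1)).prod isCompact_univ).of_isClosed_subset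
    (isClosed_range_q_zeta isClosed_cantorSet) ?_
  rintro _ ⟨z, rfl⟩
  exact ⟨Z.q_mem_Icc cantorSet_subset_unitInterval z, trivial⟩

end

/-! ### The Cantor factor and a uniform scale on the product -/

instance : CompactSpace cantorSet := isCompact_iff_compactSpace.1 isCompact_cantorSet

/-- The binary digits of a point of the Cantor set. -/
def cantorDigits (c : cantorSet) : ℕ → Bool := cantorSetHomeomorphNatToBool c

theorem continuous_cantorDigits : Continuous cantorDigits :=
  cantorSetHomeomorphNatToBool.continuous

theorem cantorDigits_bijective : Function.Bijective cantorDigits :=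
  cantorSetHomeomorphNatToBool.bijective

/-- A basis of entourages of `X(D, C)`. -/
def Close (N : ℕ) (x y : X D cantorSet) : Prop :=
  |Z.q x.1 - Z.q y.1| ≤ 1 / (N + 1 : ℝ) ∧ Theta.red N (Z.zeta x.1) = Theta.red N (Z.zeta y.1) ∧
    ∀ i < N, cantorDigits x.2 i = cantorDigits y.2 i

theorem isClosed_close (N : ℕ) : IsClosed {p : X D cantorSet × X D cantorSet | Close N p.1 p.2} := by
  have hq1 : Continuous fun p : X D cantorSet × X D cantorSet => Z.q p.1.1 :=
    Z.continuous_q.comp (continuous_fst.comp continuous_fst)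
  have hq2 : Continuous fun p : X D cantorSet × X D cantorSet => Z.q p.2.1 :=
    Z.continuous_q.comp (continuous_fst.comp continuous_snd)
  have hz1 : Continuous fun p : X D cantorSet × X D cantorSet => Theta.red N (Z.zeta p.1.1) :=
    (Theta.continuous_red N).comp
      (Z.continuous_zeta.comp (continuous_fst.comp continuous_fst))
  have hz2 : Continuous fun p : X D cantorSet × X D cantorSet => Theta.red N (Z.zeta p.2.1) :=
    (Theta.continuous_red N).comp
      (Z.continuous_zeta.comp (continuous_fst.comp continuous_snd))
  have hc1 : Continuous fun p : X D cantorSet × X D cantorSet => cantorDigits p.1.2 :=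
    continuous_cantorDigits.comp (continuous_snd.comp continuous_fst)
  have hc2 : Continuous fun p : X D cantorSet × X D cantorSet => cantorDigits p.2.2 :=
    continuous_cantorDigits.comp (continuous_snd.comp continuous_snd)
  refine (isClosed_le (hq1.sub hq2).abs continuous_const).inter
    ((isClosed_eq hz1 hz2).inter ?_)
  change IsClosed {p : X D cantorSet × X D cantorSet |
    ∀ i < N, cantorDigits p.1.2 i = cantorDigits p.2.2 i}
  simp only [ofPred_forall]
  exact isClosed_iInter fun i => isClosed_iInter fun _ =>
    isClosed_eq ((continuous_apply i).comp hc1) ((continuous_apply i).comp hc2)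

theorem Close.mono {N M : ℕ} (h : N ≤ M) {x y : X D cantorSet} (hxy : Close M x y) :
    Close N x y := by
  refine ⟨hxy.1.trans ?_, Theta.red_eq_of_le h hxy.2.1, fun i hi => hxy.2.2 i (hi.trans_le h)⟩
  have : (N : ℝ) ≤ M := by exact_mod_cast h
  exact one_div_le_one_div_of_le (by positivity) (by linarith)

theorem eq_of_close {x y : X D cantorSet} (h : ∀ N, Close N x y) : x = y := by
  have hq : Z.q x.1 = Z.q y.1 := by
    refine sub_eq_zero.1 (abs_nonpos_iff.1 (le_of_forall_pos_le_add fun ε hε => ?_))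
    obtain ⟨N, hN⟩ := exists_nat_one_div_lt hε
    rw [zero_add]
    exact (h N).1.trans hN.le
  have hz : Z.zeta x.1 = Z.zeta y.1 := Theta.eq_of_red_eq fun N => (h N).2.1
  have hc : cantorDigits x.2 = cantorDigits y.2 :=
    funext fun i => (h (i + 1)).2.2 i (Nat.lt_succ_self i)
  exact Prod.ext (Z.q_zeta_injective (Prod.ext hq hz)) (cantorDigits_bijective.1 hc)

/-- The relations `Close N` are closed and decrease to the diagonal, so by compactness one of them
misses `K`. -/
theorem exists_close_notMem {K : Set (X D cantorSet × X D cantorSet)} (hK : IsClosed K)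
    (hd : ∀ x, (x, x) ∉ K) : ∃ N, ∀ x y, Close N x y → (x, y) ∉ K := by
  obtain ⟨N, hN⟩ := hK.isCompact.elim_directed_family_closed
    (fun N => {p : X D cantorSet × X D cantorSet | Close N p.1 p.2}) isClosed_close (by
      refine eq_empty_iff_forall_notMem.2 fun ⟨x, y⟩ ⟨hp, hc⟩ => ?_
      have e : x = y := eq_of_close fun N => mem_iInter.1 hc N
      exact hd x (e ▸ hp)) (directed_of_isDirected_le fun N M h p hp => Close.mono h hp)
  exact ⟨N, fun x y hxy h => eq_empty_iff_forall_notMem.1 hN (x, y) ⟨h, hxy⟩⟩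

/-! ### Partition of the space of spirals into pieces around a gap -/

theorem exists_mem_or_mem_gap (z : Z D cantorSet) :
    Z.q z ∈ cantorSet ∨ ∃ j : Gap D cantorSet, Z.q z ∈ Ioo j.l j.r := by
  rcases z.eq_machine_or_eq_pt with ⟨a, t, rfl⟩ | ⟨j, x, rfl⟩
  · exact Or.inl a.2
  · exact Or.inr ⟨j, j.q_int_mem x⟩

theorem IsCut.ne_q {f : ℝ} (hf : IsCut f) (z : Z D cantorSet) : f ≠ Z.q z := by
  rintro rfl
  rcases exists_mem_or_mem_gap z with h | ⟨j, h⟩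
  · exact hf.1 h
  · exact hf.2 j h

/-- A spiral is never separated by a cut. Sets bounded by cuts are therefore invariant under the
shift. -/
theorem IsCut.lt_q_pt_iff {f : ℝ} (hf : IsCut f) (j : Gap D cantorSet) (p : Spiral Theta) :
    f < Z.q (j.pt p) ↔ f < j.l := by
  have hp : 0 ≤ p.pos ∧ p.pos ≤ 1 := by
    rcases p with t | x | t
    · simp [Spiral.pos]
    · exact ⟨(Spiral.intPos_mem x).1.le, (Spiral.intPos_mem x).2.le⟩
    · simp [Spiral.pos]
  have hj := sub_pos.2 j.lt
  have h1 : j.l ≤ Z.q (j.pt p) := by rw [j.q_pt]; nlinarith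
  have h2 : Z.q (j.pt p) ≤ j.r := by rw [j.q_pt]; nlinarith
  refine ⟨fun h => ?_, fun h => h.trans_le h1⟩
  rcases j.le_or_le_of_isCut hf with h' | h'
  · exact h'
  · linarith

/-- A partition of `Z(D, C)` into finitely many clopen invariant sets, each of them containing the
spiral of a gap and only points close to that spiral. -/
theorem exists_partition {δ : ℝ} (hδ : 0 < δ) :
    ∃ (I : Type) (_ : Finite I) (ι : Z D cantorSet → I) (J : I → Gap D cantorSet),
      IsLocallyConstant ι ∧ (∀ z, ι (Z.shift D cantorSet z) = ι z) ∧
      (∀ (j : Gap D cantorSet) p p', ι (j.pt p) = ι (j.pt p')) ∧ (∀ i p, ι ((J i).pt p) = i) ∧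
      ∀ z, (J (ι z)).l - δ < Z.q z ∧ Z.q z < (J (ι z)).r + δ := by
  classical
  choose a b j ha hb haz hzb h1 h2 h3 h4 using
    fun z : Z D cantorSet => exists_cuts_around (exists_mem_or_mem_gap z) hδ
  obtain ⟨S, -, hS⟩ := isCompact_univ.elim_nhds_subcover
    (fun z : Z D cantorSet => Z.q ⁻¹' Ioo (a z) (b z))
    (fun z _ => (isOpen_Ioo.preimage Z.continuous_q).mem_nhds ⟨haz z, hzb z⟩)
  set F : Finset ℝ := S.image a ∪ S.image b with hF
  have hcut : ∀ f ∈ F, IsCut f := by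
    intro f hf
    rw [hF, Finset.mem_union, Finset.mem_image, Finset.mem_image] at hf
    rcases hf with ⟨z, -, rfl⟩ | ⟨z, -, rfl⟩
    · exact ha z
    · exact hb z
  -- A cell is named by the set of cuts to its left. Cells are clopen because `q` never takes a cut
  -- as value.
  let cell : Z D cantorSet → Finset ℝ := fun z => F.filter fun f => f < Z.q z
  have hcell : ∀ z w, cell z = cell w ↔ ∀ f ∈ F, f < Z.q z ↔ f < Z.q w := fun z w =>
    Finset.filter_inj'.trans ⟨fun h f hf => h hf, fun h f hf => h f hf⟩
  have hpt : ∀ (i : Gap D cantorSet) p p', cell (i.pt p) = cell (i.pt p') := fun i p p' =>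
    (hcell _ _).2 fun f hf => by rw [(hcut f hf).lt_q_pt_iff, (hcut f hf).lt_q_pt_iff]
  have hdes : ∀ w, ∃ i : Gap D cantorSet, (∀ p, cell (i.pt p) = cell w) ∧
      ∀ z, cell z = cell w → i.l - δ < Z.q z ∧ Z.q z < i.r + δ := by
    intro w
    obtain ⟨s, hs, hw⟩ := mem_iUnion₂.1 (hS (mem_univ w))
    have haF : a s ∈ F := Finset.mem_union_left _ (Finset.mem_image_of_mem _ hs)
    have hbF : b s ∈ F := Finset.mem_union_right _ (Finset.mem_image_of_mem _ hs)
    have hsub : ∀ z, cell z = cell w → a s < Z.q z ∧ Z.q z < b s := fun z hz =>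
      ⟨((hcell _ _).1 hz _ haF).2 hw.1, lt_of_le_of_ne
        (not_lt.1 fun h => (((hcell _ _).1 hz _ hbF).1 h).not_gt hw.2) ((hb s).ne_q z).symm⟩
    -- If the spiral of the gap `j s` lies in the cell, it is the designated one. Otherwise some cut
    -- separates it from the cell, and any gap inside the cell will do.
    by_cases hsame : ∀ p, cell ((j s).pt p) = cell w
    · exact ⟨j s, hsame, fun z hz => ⟨(h1 s).trans (hsub z hz).1, (hsub z hz).2.trans (h4 s)⟩⟩
    -- the cell of `w` is on one side of the gap `j s`, hence small
    have hsmall : ∀ z z', cell z = cell w → cell z' = cell w → Z.q z < Z.q z' + δ := by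
      push Not at hsame
      obtain ⟨p, hp⟩ := hsame
      rw [Ne, hcell] at hp
      push Not at hp
      obtain ⟨f, hf, hfp⟩ := hp
      rw [← not_lt, ← not_lt, (hcut f hf).lt_q_pt_iff] at hfp
      intro z z' hz hz'
      have hzf := (hcell _ _).1 hz f hf
      have hzf' := (hcell _ _).1 hz' f hf
      have := hsub z hz
      have := hsub z' hz'
      rcases hfp with ⟨hf1, hf2⟩ | ⟨hf1, hf2⟩
      · rw [← hzf, not_lt] at hf2
        linarith [h1 s]
      · rw [← hzf'] at hf2
        have := ((j s).le_or_le_of_isCut (hcut f hf)).resolve_left hf1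
        linarith [h4 s]
    obtain ⟨i, hi⟩ : ∃ i : Gap D cantorSet, ∀ p, cell (i.pt p) = cell w := by
      rcases w.eq_machine_or_eq_pt with ⟨c, t, rfl⟩ | ⟨i, x, rfl⟩
      -- No cut of `F` is within `η` of `c`, so a gap within this distance lies in the cell of `c`.
      · obtain ⟨η, hη, hball⟩ := Metric.isOpen_iff.1
          (F.finite_toSet.isClosed.isOpen_compl) (c : ℝ)
          fun h => ((hcut _ h).ne_q (Z.machine c t)) rfl
        obtain ⟨i, hi1, hi2⟩ := exists_gap_Ioo c.2
          (⟨by linarith, by linarith⟩ : (c : ℝ) ∈ Ioo (c - η) (c + η))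
        refine ⟨i, fun p => (hcell _ _).2 fun f hf => ?_⟩
        rw [(hcut f hf).lt_q_pt_iff, Z.q_machine]
        have hfar : ¬ (f ∈ Metric.ball (c : ℝ) η) := fun h => hball h hf
        rw [Metric.mem_ball, Real.dist_eq, abs_lt, not_and_or, not_lt, not_lt] at hfar
        have := i.lt
        rcases hfar with h | h <;> constructor <;> intro <;> linarith
      · exact ⟨i, fun p => hpt i p _⟩
    refine ⟨i, hi, fun z hz => ⟨?_, ?_⟩⟩
    · have := hsmall _ z (hi (.negInf 0)) hz
      rw [i.q_negInf] at this
      linarith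
    · have := hsmall z _ hz (hi (.posInf 0))
      rw [i.q_posInf] at this
      linarith
  choose i hi1 hi2 using hdes
  refine ⟨range cell, ?_, fun z => ⟨cell z, z, rfl⟩, fun c => i c.2.choose, ?_, ?_,
    fun j p p' => Subtype.ext (hpt j p p'), ?_, ?_⟩
  · exact (F.powerset.finite_toSet.subset (by
      rintro _ ⟨z, rfl⟩
      exact Finset.mem_coe.2 (Finset.mem_powerset.2 (Finset.filter_subset _ _)))).to_subtype
  · refine (IsLocallyConstant.iff_eventually_eq _).2 fun z => ?_
    have hev : ∀ᶠ w in 𝓝 z, ∀ f ∈ F, (f < Z.q w ↔ f < Z.q z) := by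
      refine (Filter.eventually_all_finset F).2 fun f hf => ?_
      rcases ((hcut f hf).ne_q z).lt_or_gt with h | h
      · filter_upwards [Z.continuous_q.continuousAt.eventually (lt_mem_nhds h)] with w hw
        exact iff_of_true hw h
      · filter_upwards [Z.continuous_q.continuousAt.eventually (gt_mem_nhds h)] with w hw
        exact iff_of_false hw.not_gt h.not_gt
    exact hev.mono fun w hw => Subtype.ext ((hcell _ _).2 hw)
  · intro z
    refine Subtype.ext ?_
    rcases z.eq_machine_or_eq_pt with ⟨c, t, rfl⟩ | ⟨j, x, rfl⟩
    · exact (hcell _ _).2 fun f _ => by rw [Z.shift_machine, Z.q_machine, Z.q_machine]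
    · exact hpt j _ _
  · rintro ⟨c, hc⟩ p
    exact Subtype.ext ((hi1 _ p).trans hc.choose_spec)
  · intro z
    exact hi2 _ z (⟨z, rfl⟩ : ∃ w, cell w = cell z).choose_spec.symm

/-! ### Maps between spirals and finite spirals -/

namespace Spiral

variable {G H : Type} [Ring G] [Ring H]

/-- The power `τ ^ c` of the shift. -/
def translate (c : ℤ) : Spiral G → Spiral G
  | negInf t => negInf (t + c)
  | int x => int (x + c)
  | posInf t => posInf (t + c)

theorem translate_shift (c : ℤ) (p : Spiral G) : translate c p.shift = (translate c p).shift := by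
  rcases p with t | x | t
  · exact congrArg negInf (add_right_comm t 1 (c : G))
  · exact congrArg int (add_right_comm x 1 c)
  · exact congrArg posInf (add_right_comm t 1 (c : G))

theorem zeta_translate (c : ℤ) (p : Spiral G) : (translate c p).zeta = p.zeta + c := by
  rcases p with t | x | t
  · rfl
  · exact Int.cast_add x c
  · rfl

theorem translate_surjective (c : ℤ) : Function.Surjective (translate c : Spiral G → Spiral G) := by
  rintro (t | x | t)
  · exact ⟨negInf (t - c), congrArg negInf (sub_add_cancel t _)⟩
  · exact ⟨int (x - c), congrArg int (sub_add_cancel x _)⟩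
  · exact ⟨posInf (t - c), congrArg posInf (sub_add_cancel t _)⟩

theorem map_shift (f : G →+* H) (p : Spiral G) : map f p.shift = (map f p).shift := by
  rcases p with t | x | t
  · simp [map, shift]
  · rfl
  · simp [map, shift]

theorem map_surjective {f : G →+* H} (hf : Function.Surjective f) :
    Function.Surjective (map f) := by
  rintro (t | x | t)
  · exact (hf t).elim fun s hs => ⟨negInf s, congrArg negInf hs⟩
  · exact ⟨int x, rfl⟩
  · exact (hf t).elim fun s hs => ⟨posInf s, congrArg posInf hs⟩

theorem zeta_map (f : G →+* H) (p : Spiral G) : (map f p).zeta = f p.zeta := by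
  rcases p with t | x | t
  · rfl
  · exact (map_intCast f x).symm
  · rfl

/-- The collapse of a spiral to one of its ends, or the identity, according to the kind of a
letter. -/
def collapse : Kind → Spiral G → Spiral G
  | .L => fun p => negInf p.zeta
  | .M => id
  | .R => fun p => posInf p.zeta

theorem zeta_collapse (K : Kind) (p : Spiral G) : (collapse K p).zeta = p.zeta := by
  cases K <;> rfl

end Spiral

/-- The kind of the composition of two collapses. -/
def Kind.comp : Kind → Kind → Kind
  | .L, _ => .L
  | .M, K => K
  | .R, _ => .R

theorem Spiral.collapse_collapse {G : Type} [Ring G] (K K' : Kind) (p : Spiral G) :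
    collapse K (collapse K' p) = collapse (K.comp K') p := by
  cases K
  · exact congrArg negInf (zeta_collapse K' p)
  · rfl
  · exact congrArg posInf (zeta_collapse K' p)

/-! ### Coordinates on finite spirals and classification of walks -/

namespace FinSpiral

/-- The truncation of the first coordinate to `[-n, n]`. -/
def clamp (n : ℕ) : FinSpiral n → ℤ :=
  Quot.lift (fun | .negInf _ => -(n : ℤ) | .int x => max (-n) (min x n) | .posInf _ => n) (by
    rintro _ _ (⟨x, hx⟩ | ⟨x, hx⟩) <;> dsimp only <;> omega)

/-- The second coordinate. -/
def zeta (n : ℕ) : FinSpiral n → ZMod n.factorial :=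
  Quot.lift Spiral.zeta (by rintro _ _ (⟨x, hx⟩ | ⟨x, hx⟩) <;> rfl)

theorem mk_int_of_le {n : ℕ} {x : ℤ} (hx : x ≤ -n) :
    mk n (.int x) = mk n (.negInf (x : ZMod n.factorial)) :=
  Quot.sound (.left x hx)

theorem mk_int_of_ge {n : ℕ} {x : ℤ} (hx : (n : ℤ) ≤ x) :
    mk n (.int x) = mk n (.posInf (x : ZMod n.factorial)) :=
  Quot.sound (.right x hx)

instance : Subsingleton (FinSpiral 0) := by
  refine ⟨?_⟩
  have : Subsingleton (ZMod (Nat.factorial 0)) := inferInstanceAs (Subsingleton (ZMod 1))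
  have hl : ∀ y : ℤ, y ≤ 0 → ∀ t, mk 0 (.int y) = mk 0 (.negInf t) := fun y hy t =>
    (mk_int_of_le hy).trans (congrArg _ (congrArg _ (Subsingleton.elim _ _)))
  have hr : ∀ y : ℤ, 0 ≤ y → ∀ t, mk 0 (.int y) = mk 0 (.posInf t) := fun y hy t =>
    (mk_int_of_ge hy).trans (congrArg _ (congrArg _ (Subsingleton.elim _ _)))
  suffices h : ∀ s : FinSpiral 0, s = mk 0 (.int 0) from fun s s' => (h s).trans (h s').symm
  rintro ⟨t | x | t⟩
  · exact (hl 0 le_rfl t).symm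
  · rcases le_total x 0 with h | h
    · exact (hl x h 0).trans (hl 0 le_rfl 0).symm
    · exact (hr x h 0).trans (hr 0 le_rfl 0).symm
  · exact (hr 0 le_rfl t).symm

theorem eq_mk (n : ℕ) (s : FinSpiral n) :
    (clamp n s = -n ∧ s = mk n (.negInf (zeta n s))) ∨
    (clamp n s = n ∧ s = mk n (.posInf (zeta n s))) ∨
    (-(n : ℤ) < clamp n s ∧ clamp n s < n ∧ s = mk n (.int (clamp n s))) := by
  rcases s with ⟨t | x | t⟩
  · exact Or.inl ⟨rfl, rfl⟩
  · have hc : clamp n (mk n (.int x)) = max (-(n : ℤ)) (min x n) := rfl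
    change (clamp n (mk n (.int x)) = -n ∧ mk n (.int x) = mk n (.negInf (x : ZMod _))) ∨
      (clamp n (mk n (.int x)) = n ∧ mk n (.int x) = mk n (.posInf (x : ZMod _))) ∨
      (-(n : ℤ) < clamp n (mk n (.int x)) ∧ clamp n (mk n (.int x)) < n ∧
        mk n (.int x) = mk n (.int (clamp n (mk n (.int x)))))
    rcases le_or_gt x (-n) with h | h
    · exact Or.inl ⟨by omega, mk_int_of_le h⟩
    · rcases le_or_gt (n : ℤ) x with h' | h'
      · exact Or.inr (Or.inl ⟨by omega, mk_int_of_ge h'⟩)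
      · rw [hc, show max (-(n : ℤ)) (min x n) = x by omega]
        exact Or.inr (Or.inr ⟨h, h', rfl⟩)
  · exact Or.inr (Or.inl ⟨rfl, rfl⟩)

/-- For positive `n` the truncated position distinguishes the two ends from each other and from the
interior points. For `n = 0` it does not, but then the finite spiral is a single point. -/
theorem ext_clamp_zeta {n : ℕ} {s s' : FinSpiral n} (h : clamp n s = clamp n s')
    (h' : zeta n s = zeta n s') : s = s' := by
  rcases n.eq_zero_or_pos with rfl | hn
  · exact Subsingleton.elim _ _
  rcases eq_mk n s with ⟨h1, h2⟩ | ⟨h1, h2⟩ | ⟨h1, h1', h2⟩ <;>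
    rcases eq_mk n s' with ⟨h3, h4⟩ | ⟨h3, h4⟩ | ⟨h3, h3', h4⟩ <;>
    first
    | omega
    | (rw [h2, h4, h'])
    | (rw [h2, h4, h])

theorem Rel.zeta_eq {n : ℕ} {s s' : FinSpiral n} (h : Rel n s s') :
    zeta n s' = zeta n s + 1 := by
  obtain ⟨p, _, rfl, rfl, rfl⟩ := h
  rcases p with t | x | t
  · rfl
  · exact Int.cast_add x 1 |>.trans (congrArg _ Int.cast_one)
  · rfl

theorem Rel.clamp_eq {n : ℕ} {s s' : FinSpiral n} (h : Rel n s s') :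
    (clamp n s = -n ∧ clamp n s' = -n) ∨ (clamp n s = n ∧ clamp n s' = n) ∨
      (clamp n s' = clamp n s + 1 ∧ -(n : ℤ) ≤ clamp n s ∧ clamp n s' ≤ n) := by
  obtain ⟨p, _, rfl, rfl, rfl⟩ := h
  rcases p with t | x | t
  · exact Or.inl ⟨rfl, rfl⟩
  · change (max (-(n : ℤ)) (min x n) = -n ∧ max (-(n : ℤ)) (min (x + 1) n) = -n) ∨
      (max (-(n : ℤ)) (min x n) = n ∧ max (-(n : ℤ)) (min (x + 1) n) = n) ∨
      (max (-(n : ℤ)) (min (x + 1) n) = max (-(n : ℤ)) (min x n) + 1 ∧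
        -(n : ℤ) ≤ max (-(n : ℤ)) (min x n) ∧ max (-(n : ℤ)) (min (x + 1) n) ≤ n)
    omega
  · exact Or.inr (Or.inl ⟨rfl, rfl⟩)

section Walk

variable {n : ℕ} {w : ℤ → FinSpiral n}

theorem zeta_walk (hw : ∀ x, Rel n (w x) (w (x + 1))) (x : ℤ) :
    zeta n (w x) = zeta n (w 0) + x := by
  induction x using Int.induction_on with
  | zero => simp
  | succ i ih =>
    rw [(hw i).zeta_eq, ih]
    push_cast
    ring
  | pred i ih =>
    have h := (hw (-(i : ℤ) - 1)).zeta_eq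
    rw [sub_add_cancel, ih] at h
    rw [eq_sub_of_add_eq h.symm]
    push_cast
    ring

/-- From an interior position a walk can only advance by one at each step until it is absorbed at
`n`; backwards in time it is likewise absorbed at `-n`. -/
theorem clamp_walk (hw : ∀ x, Rel n (w x) (w (x + 1))) {v : ℤ} (hv : -(n : ℤ) < v) (hv' : v < n)
    {x₀ : ℤ} (h₀ : clamp n (w x₀) = v) (x : ℤ) :
    clamp n (w x) = max (-(n : ℤ)) (min (x - x₀ + v) n) := by
  induction x using Int.inductionOn' (b := x₀) with
  | zero => omega
  | succ k hk ih =>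
    have := (hw k).clamp_eq
    omega
  | pred k hk ih =>
    have := (hw (k - 1)).clamp_eq
    rw [sub_add_cancel] at this
    omega

/-- A walk in a finite spiral that passes through `0` is the image of the orbit of integers. -/
theorem walk_eq_mk_int (hw : ∀ x, Rel n (w x) (w (x + 1))) {v x₀ : ℤ}
    (hv : v = 0 ∨ -(n : ℤ) < v ∧ v < n) (h₀ : w x₀ = mk n (.int v)) (x : ℤ) :
    w x = mk n (.int (x - x₀ + v)) := by
  rcases n.eq_zero_or_pos with rfl | hn
  · exact Subsingleton.elim _ _
  refine ext_clamp_zeta ?_ ?_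
  · refine clamp_walk hw (v := v) (by omega) (by omega) (x₀ := x₀) ?_ x
    rw [h₀]
    change max (-(n : ℤ)) (min v n) = v
    omega
  · have h1 := zeta_walk hw x
    have h2 := zeta_walk hw x₀
    rw [h₀] at h2
    have h3 : zeta n (mk n (.int v)) = (v : ZMod n.factorial) := rfl
    have h4 : zeta n (mk n (.int (x - x₀ + v))) = ((x - x₀ + v : ℤ) : ZMod n.factorial) := rfl
    rw [h3] at h2
    rw [h1, h4]
    push_cast
    rw [h2]
    ring

end Walk

/-- The map from the spiral to the finite spiral `Σₙ`. -/
def ofSpiral (n : ℕ) (p : Spiral Theta) : FinSpiral n := mk n (p.map (Theta.red n))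

theorem ofSpiral_surjective (n : ℕ) : Function.Surjective (ofSpiral n) :=
  Quot.mk_surjective.comp (Spiral.map_surjective (Theta.red_surjective n))

theorem rel_ofSpiral (n : ℕ) (p : Spiral Theta) : Rel n (ofSpiral n p) (ofSpiral n p.shift) :=
  ⟨_, _, rfl, rfl, congrArg (mk n) (Spiral.map_shift _ p).symm⟩

theorem exists_of_rel {n : ℕ} {s s' : FinSpiral n} (h : Rel n s s') :
    ∃ p, ofSpiral n p = s ∧ ofSpiral n p.shift = s' := by
  obtain ⟨p, _, rfl, rfl, rfl⟩ := h
  obtain ⟨p, rfl⟩ := Spiral.map_surjective (Theta.red_surjective n) p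
  exact ⟨p, rfl, congrArg (mk n) (Spiral.map_shift _ p)⟩

theorem ofSpiral_negInf_eq {n : ℕ} {s t : Theta} (h : Theta.red n s = Theta.red n t) :
    ofSpiral n (.negInf s) = ofSpiral n (.negInf t) :=
  congrArg (fun t => mk n (.negInf t)) h

theorem ofSpiral_posInf_eq {n : ℕ} {s t : Theta} (h : Theta.red n s = Theta.red n t) :
    ofSpiral n (.posInf s) = ofSpiral n (.posInf t) :=
  congrArg (fun t => mk n (.posInf t)) h

theorem ofSpiral_int_of_le {n : ℕ} {x : ℤ} (hx : x ≤ -n) :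
    ofSpiral n (.int x) = ofSpiral n (.negInf x) :=
  (mk_int_of_le hx).trans (congrArg (fun t => mk n (.negInf t)) (map_intCast (Theta.red n) x).symm)

theorem ofSpiral_int_of_ge {n : ℕ} {x : ℤ} (hx : (n : ℤ) ≤ x) :
    ofSpiral n (.int x) = ofSpiral n (.posInf x) :=
  (mk_int_of_ge hx).trans (congrArg (fun t => mk n (.posInf t)) (map_intCast (Theta.red n) x).symm)

/-- The type of a walk in a finite spiral: it is the collapsed image of the orbit of integers. -/
theorem exists_walk_eq {n : ℕ} {w : ℤ → FinSpiral n} (hw : ∀ x, Rel n (w x) (w (x + 1))) :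
    ∃ (K : Kind) (c : ℤ), ∀ x, w x = ofSpiral n (Spiral.collapse K (.int (x + c))) := by
  rcases n.eq_zero_or_pos with rfl | hn
  · exact ⟨.M, 0, fun _ => Subsingleton.elim _ _⟩
  by_cases h : ∃ x₀, -(n : ℤ) < clamp n (w x₀) ∧ clamp n (w x₀) < n
  · obtain ⟨x₀, h1, h2⟩ := h
    have h0 : w x₀ = mk n (.int (clamp n (w x₀))) := by
      rcases eq_mk n (w x₀) with h | h | h
      · omega
      · omega
      · exact h.2.2
    refine ⟨.M, -x₀ + clamp n (w x₀), fun x => ?_⟩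
    rw [walk_eq_mk_int hw (Or.inr ⟨h1, h2⟩) h0 x, sub_eq_add_neg, add_assoc]
    rfl
  -- The position rises by at most one per step, so a walk without interior positions cannot change
  -- ends.
  · push Not at h
    have hcl : ∀ x, clamp n (w x) = clamp n (w 0) := fun x => by
      induction x using Int.induction_on with
      | zero => rfl
      | succ i ih =>
        have h1 := (hw i).clamp_eq
        have h2 := h i
        have h3 := h (i + 1)
        omega
      | pred i ih =>
        have h1 := (hw (-(i : ℤ) - 1)).clamp_eq
        rw [sub_add_cancel] at h1
        have h2 := h (-(i : ℤ))
        have h3 := h (-(i : ℤ) - 1)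
        omega
    obtain ⟨c, hc⟩ := ZMod.intCast_surjective (zeta n (w 0))
    have hz : ∀ x : ℤ, zeta n (w x) = Theta.red n ((x + c : ℤ) : Theta) := fun x => by
      rw [zeta_walk hw, ← hc, map_intCast]
      push_cast
      ring
    rcases eq_mk n (w 0) with h0 | h0 | h0
    · exact ⟨.L, c, fun x => ext_clamp_zeta ((hcl x).trans h0.1) (hz x)⟩
    · exact ⟨.R, c, fun x => ext_clamp_zeta ((hcl x).trans h0.1) (hz x)⟩
    · have := h 0
      omega

end FinSpiral

/-! ### The projections of the inverse system -/

namespace W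

/-- The kind of the composed projection from the finite spiral of the word `u`. -/
def kind (n : ℕ) : ∀ k : ℕ, (Fin (n + k) → Letter) → Kind
  | 0, _ => .M
  | k + 1, u => (kind n k (Fin.init u)).comp (u (Fin.last (n + k))).1

theorem xi_ofSpiral (n : ℕ) (u : Fin (n + 1) → Letter) (p : Spiral Theta) :
    xi n (u, FinSpiral.ofSpiral (n + 1) p) =
      (Fin.init u, FinSpiral.ofSpiral n (Spiral.collapse (u (Fin.last n)).1 p)) := by
  have hc : ∀ t, FinSpiral.castFact n (Theta.red (n + 1) t) = Theta.red n t :=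
    Theta.castHom_red n.le_succ
  have hz : FinSpiral.castFact n (p.map (Theta.red (n + 1))).zeta = Theta.red n p.zeta := by
    rw [Spiral.zeta_map, hc]
  refine Prod.ext rfl ?_
  change (match (u (Fin.last n)).1 with
    | .L => FinSpiral.xiL n (FinSpiral.ofSpiral (n + 1) p)
    | .M => FinSpiral.xiM n (FinSpiral.ofSpiral (n + 1) p)
    | .R => FinSpiral.xiR n (FinSpiral.ofSpiral (n + 1) p)) = FinSpiral.ofSpiral n _
  rcases (u (Fin.last n)).1 with _ | _ | _
  · exact congrArg (fun t => FinSpiral.mk n (.negInf t)) hz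
  · refine congrArg (FinSpiral.mk n) ?_
    rcases p with t | x | t
    · exact congrArg Spiral.negInf (hc t)
    · rfl
    · exact congrArg Spiral.posInf (hc t)
  · exact congrArg (fun t => FinSpiral.mk n (.posInf t)) hz

/-- Collapses do not change the residue, so the last one applied wins: the first letter after
position `n` that is not an `M` decides the kind. -/
theorem xiIter_ofSpiral (n : ℕ) : ∀ (k : ℕ) (u : Fin (n + k) → Letter) (p : Spiral Theta),
    xiIter n k (u, FinSpiral.ofSpiral (n + k) p) = (fun i => u (Fin.castAdd k i),
      FinSpiral.ofSpiral n (Spiral.collapse (kind n k u) p))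
  | 0, _, _ => rfl
  | k + 1, u, p => by
    have h := xi_ofSpiral (n + k) u p
    change xiIter n k (xi (n + k) (u, FinSpiral.ofSpiral (n + k + 1) p)) = _
    rw [h, xiIter_ofSpiral n k, Spiral.collapse_collapse]
    rfl

/-- Repeating one letter realizes each kind. At least one letter is needed, because the empty
extension has kind `M`. -/
theorem kind_eq (n : ℕ) {K : Kind} : ∀ (k : ℕ) (u : Fin (n + k) → Letter),
    (∀ i : Fin k, (u (Fin.natAdd n i)).1 = K) → 0 < k → kind n k u = K
  | 0, _, _, hk => absurd hk (lt_irrefl 0)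
  | k + 1, u, hu, _ => by
    have hl : (u (Fin.last (n + k))).1 = K := hu (Fin.last k)
    rw [kind, hl]
    rcases k.eq_zero_or_pos with rfl | hk
    · rfl
    · rw [kind_eq n k (Fin.init u) (fun i => hu i.castSucc) hk]
      cases K <;> rfl

end W

/-! ### The projection of the space of spirals to one of its spirals -/

namespace Gap

variable {A A₀ : Set ℝ}

open Classical in
/-- The equivariant retraction of `Z(A, A₀)` to the spiral of the gap `j`. -/
def proj (j : Gap A A₀) (z : Z A A₀) : Spiral Theta :=
  if h : ∃ x : ℤ, z = j.pt (.int x) then .int h.choose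
  else if Z.q z ≤ j.l then .negInf (Z.zeta z) else .posInf (Z.zeta z)

theorem proj_int (j : Gap A A₀) (x : ℤ) : j.proj (j.pt (.int x)) = .int x := by
  have h : ∃ y : ℤ, j.pt (.int x) = j.pt (.int y) := ⟨x, rfl⟩
  rw [proj, dif_pos h]
  exact congrArg Spiral.int (j.q_int_strictMono.injective (congrArg Z.q h.choose_spec)).symm

theorem proj_of_le (j : Gap A A₀) {z : Z A A₀} (hz : Z.q z ≤ j.l) :
    j.proj z = .negInf (Z.zeta z) := by
  rw [proj, dif_neg, if_pos hz]
  rintro ⟨x, rfl⟩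
  exact (j.q_int_mem x).1.not_ge hz

theorem proj_of_ge (j : Gap A A₀) {z : Z A A₀} (hz : j.r ≤ Z.q z) :
    j.proj z = .posInf (Z.zeta z) := by
  rw [proj, dif_neg, if_neg (j.lt.trans_le hz).not_ge]
  rintro ⟨x, rfl⟩
  exact (j.q_int_mem x).2.not_ge hz

theorem trichotomy (j : Gap A A₀) (z : Z A A₀) :
    Z.q z ≤ j.l ∨ j.r ≤ Z.q z ∨ ∃ x : ℤ, z = j.pt (.int x) := by
  by_contra! h
  exact (j.eq_pt_of_q_mem ⟨h.1, h.2.1⟩).elim h.2.2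

theorem proj_pt (j : Gap A A₀) (p : Spiral Theta) : j.proj (j.pt p) = p := by
  rcases p with t | x | t
  · exact j.proj_of_le (j.q_negInf t).le
  · exact j.proj_int x
  · exact j.proj_of_ge (j.q_posInf t).ge

theorem zeta_proj (j : Gap A A₀) (z : Z A A₀) : (j.proj z).zeta = Z.zeta z := by
  rcases j.trichotomy z with h | h | ⟨x, rfl⟩
  · rw [j.proj_of_le h, Spiral.zeta]
  · rw [j.proj_of_ge h, Spiral.zeta]
  · rw [j.proj_int, zeta_pt]

theorem proj_shift (j : Gap A A₀) (z : Z A A₀) :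
    j.proj (Z.shift A A₀ z) = (j.proj z).shift := by
  rcases z.eq_machine_or_eq_pt with ⟨a, t, rfl⟩ | ⟨i, x, rfl⟩
  · rw [Z.shift_machine]
    rcases j.le_or_le a.2 with h | h
    · rw [j.proj_of_le (z := Z.machine a t) h, j.proj_of_le (z := Z.machine a (t + 1)) h]
      rfl
    · rw [j.proj_of_ge (z := Z.machine a t) h, j.proj_of_ge (z := Z.machine a (t + 1)) h]
      rfl
  · rw [shift_pt]
    by_cases hij : i = j
    · subst hij
      rw [proj_pt, proj_pt]
    · have h0 := i.q_int_mem x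
      have h1 := i.q_int_mem (x + 1)
      have hz : Z.zeta (i.pt (.int (x + 1))) = Z.zeta (i.pt (.int x)) + 1 := by
        rw [zeta_pt, zeta_pt, Spiral.zeta, Spiral.zeta]
        push_cast
        rfl
      change j.proj (i.pt (.int (x + 1))) = _
      rcases Gap.le_or_le_of_ne hij with h | h
      · rw [j.proj_of_le (h0.2.le.trans h), j.proj_of_le (h1.2.le.trans h), hz]
        rfl
      · rw [j.proj_of_ge (h.trans h0.1.le), j.proj_of_ge (h.trans h1.1.le), hz]
        rfl

/-- The map of `Z(A, A₀)` to the finite spiral `Σ_N`, for the gap `j`, translated by `c`. -/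
def toFin (j : Gap A A₀) (c : ℤ) (N : ℕ) (z : Z A A₀) : FinSpiral N :=
  FinSpiral.ofSpiral N ((j.proj z).translate c)

theorem toFin_of_le (j : Gap A A₀) (c : ℤ) (N : ℕ) {z : Z A A₀} (h : Z.q z ≤ j.l) :
    j.toFin c N z = FinSpiral.ofSpiral N (.negInf (Z.zeta z + c)) := by
  rw [toFin, j.proj_of_le h]
  rfl

theorem toFin_of_ge (j : Gap A A₀) (c : ℤ) (N : ℕ) {z : Z A A₀} (h : j.r ≤ Z.q z) :
    j.toFin c N z = FinSpiral.ofSpiral N (.posInf (Z.zeta z + c)) := by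
  rw [toFin, j.proj_of_ge h]
  rfl

theorem toFin_int (j : Gap A A₀) (c : ℤ) (N : ℕ) (x : ℤ) :
    j.toFin c N (j.pt (.int x)) = FinSpiral.ofSpiral N (.int (x + c)) := by
  rw [toFin, j.proj_int]
  rfl

theorem zeta_toFin (j : Gap A A₀) (c : ℤ) (N : ℕ) (z : Z A A₀) :
    FinSpiral.zeta N (j.toFin c N z) = Theta.red N (Z.zeta z + c) := by
  refine (Spiral.zeta_map (Theta.red N) _).trans ?_
  rw [Spiral.zeta_translate, zeta_proj]

theorem clamp_toFin_int (j : Gap A A₀) (c : ℤ) (N : ℕ) (x : ℤ) :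
    FinSpiral.clamp N (j.toFin c N (j.pt (.int x))) =
      max (-(N : ℤ)) (min (x + c) N) := by
  rw [toFin_int]
  rfl

theorem clamp_toFin_of_le (j : Gap A A₀) (c : ℤ) (N : ℕ) {z : Z A A₀} (h : Z.q z ≤ j.l) :
    FinSpiral.clamp N (j.toFin c N z) = -N := by
  rw [j.toFin_of_le c N h]
  rfl

theorem clamp_toFin_of_ge (j : Gap A A₀) (c : ℤ) (N : ℕ) {z : Z A A₀} (h : j.r ≤ Z.q z) :
    FinSpiral.clamp N (j.toFin c N z) = N := by
  rw [j.toFin_of_ge c N h]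
  rfl

/-- Close to a point at or beyond an end of the gap, the only wandering points of the gap have
translated positions beyond `-N` or `N`, where `Σ_N` identifies them with the end. The wandering
points of the gap themselves are isolated. -/
theorem isLocallyConstant_toFin (j : Gap A A₀) (c : ℤ) (N : ℕ) :
    IsLocallyConstant (j.toFin c N) := by
  refine (IsLocallyConstant.iff_eventually_eq _).2 fun z => ?_
  have hζ : ∀ᶠ w in 𝓝 z, Theta.red N (Z.zeta w) = Theta.red N (Z.zeta z) :=
    ((Theta.continuous_red N).comp Z.continuous_zeta).continuousAt.preimage_mem_nhds
      ((isOpen_discrete {Theta.red N (Z.zeta z)}).mem_nhds rfl)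
  rcases j.trichotomy z with h | h | ⟨x, rfl⟩
  · have hlt : Z.q z < Z.q (j.pt (.int (-N - c))) := h.trans_lt (j.q_int_mem _).1
    filter_upwards [hζ, Z.continuous_q.continuousAt.eventually (gt_mem_nhds hlt)] with w hw hq
    refine FinSpiral.ext_clamp_zeta ?_ ?_
    · rw [j.clamp_toFin_of_le c N h]
      rcases j.trichotomy w with h' | h' | ⟨x, rfl⟩
      · rw [j.clamp_toFin_of_le c N h']
      · exact absurd (hq.trans (j.q_int_mem _).2) h'.not_gt
      · have := j.q_int_strictMono.lt_iff_lt.1 hq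
        rw [clamp_toFin_int]
        omega
    · rw [zeta_toFin, zeta_toFin, map_add, map_add, hw]
  · have hlt : Z.q (j.pt (.int (N - c))) < Z.q z := (j.q_int_mem _).2.trans_le h
    filter_upwards [hζ, Z.continuous_q.continuousAt.eventually (lt_mem_nhds hlt)] with w hw hq
    refine FinSpiral.ext_clamp_zeta ?_ ?_
    · rw [j.clamp_toFin_of_ge c N h]
      rcases j.trichotomy w with h' | h' | ⟨x, rfl⟩
      · exact absurd ((j.q_int_mem _).1.trans hq) h'.not_gt
      · rw [j.clamp_toFin_of_ge c N h']
      · have := j.q_int_strictMono.lt_iff_lt.1 hq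
        rw [clamp_toFin_int]
        omega
    · rw [zeta_toFin, zeta_toFin, map_add, map_add, hw]
  · filter_upwards [(isOpen_Ioo.preimage Z.continuous_q).mem_nhds (Z.q_int_mem_Ioo j x)] with w hw
    rw [Z.eq_int_of_q_mem j x w hw]
    rfl

/-- The fibers of the map to `Σ_N` are small outside of the gap, for large `N`. -/
theorem eq_or_near_of_toFin_eq (j : Gap A A₀) {η : ℝ} (hη : 0 < η) (c : ℤ) : ∃ N₀ : ℕ, ∀ N ≥ N₀,
    ∀ z w : Z A A₀, j.toFin c N z = j.toFin c N w → Theta.red N (Z.zeta z) = Theta.red N (Z.zeta w) ∧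
      (z = w ∨ (Z.q z < j.l + η ∧ Z.q w < j.l + η) ∨ (j.r - η < Z.q z ∧ j.r - η < Z.q w)) := by
  obtain ⟨B, hB⟩ := j.exists_q_near hη
  -- A translated position truncated to an end then comes from an integer beyond `B` in absolute
  -- value. The extra 1 keeps `-N` and `N` distinct.
  refine ⟨B + c.natAbs + 1, fun N hN z w h => ⟨?_, ?_⟩⟩
  · have hz := congrArg (FinSpiral.zeta N) h
    rw [zeta_toFin, zeta_toFin, map_add, map_add] at hz
    exact add_right_cancel hz
  have hc := congrArg (FinSpiral.clamp N) h
  have hl : ∀ z, FinSpiral.clamp N (j.toFin c N z) = -N → Z.q z < j.l + η := fun z hz => by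
    rcases j.trichotomy z with h' | h' | ⟨x, rfl⟩
    · linarith
    · rw [j.clamp_toFin_of_ge c N h'] at hz
      omega
    · rw [clamp_toFin_int] at hz
      exact (hB x).1 (by omega)
  have hr : ∀ z, FinSpiral.clamp N (j.toFin c N z) = N → j.r - η < Z.q z := fun z hz => by
    rcases j.trichotomy z with h' | h' | ⟨x, rfl⟩
    · rw [j.clamp_toFin_of_le c N h'] at hz
      omega
    · linarith
    · rw [clamp_toFin_int] at hz
      exact (hB x).2 (by omega)
  by_cases h1 : FinSpiral.clamp N (j.toFin c N z) = -N
  · exact Or.inr (Or.inl ⟨hl z h1, hl w (hc ▸ h1)⟩)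
  by_cases h2 : FinSpiral.clamp N (j.toFin c N z) = N
  · exact Or.inr (Or.inr ⟨hr z h2, hr w (hc ▸ h2)⟩)
  rcases j.trichotomy z with h' | h' | ⟨x, rfl⟩
  · exact absurd (j.clamp_toFin_of_le c N h') h1
  · exact absurd (j.clamp_toFin_of_ge c N h') h2
  rcases j.trichotomy w with h' | h' | ⟨y, rfl⟩
  · exact absurd (hc.trans (j.clamp_toFin_of_le c N h')) h1
  · exact absurd (hc.trans (j.clamp_toFin_of_ge c N h')) h2
  rw [clamp_toFin_int] at h1 h2 hc
  rw [clamp_toFin_int] at hc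
  obtain rfl : x = y := by omega
  exact Or.inl rfl

end Gap

/-! ### The pieces of an action map -/

theorem FinSpiral.ofSpiral_collapse_eq {n : ℕ} (K : Kind) {p p' : Spiral Theta}
    (hζ : Theta.red n p.zeta = Theta.red n p'.zeta)
    (hc : clamp n (ofSpiral n p) = clamp n (ofSpiral n p')) :
    ofSpiral n (p.collapse K) = ofSpiral n (p'.collapse K) := by
  cases K
  · exact ofSpiral_negInf_eq hζ
  · exact ext_clamp_zeta hc (by
      change (p.map _).zeta = (p'.map _).zeta
      rw [Spiral.zeta_map, Spiral.zeta_map, hζ])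
  · exact ofSpiral_posInf_eq hζ

/-- Far out towards its end, the orbit of the gap still meets every residue class modulo `N!`, so a
point near that end has orbit points close to it. -/
theorem Gap.exists_int_close_left (j : Gap D cantorSet) {z : Z D cantorSet} {N : ℕ}
    (hz : |Z.q z - j.l| < 1 / (N + 1 : ℝ)) (B : ℤ) {γ γ' : cantorSet}
    (hγ : ∀ i < N, cantorDigits γ i = cantorDigits γ' i) :
    ∃ x : ℤ, x ≤ B ∧ Close N (z, γ) (j.pt (.int x), γ') := by
  obtain ⟨B', hB'⟩ := j.exists_q_near (sub_pos.2 hz)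
  obtain ⟨x, hx, hx'⟩ := Theta.exists_int_le N (Theta.red N (Z.zeta z)) (min B (-B'))
  refine ⟨x, hx.trans (min_le_left _ _), ?_, ?_, hγ⟩
  · have h1 := (hB' x).1 (hx.trans (min_le_right _ _))
    have h2 := (j.q_int_mem x).1
    have h3 := abs_le.1 (le_refl |Z.q z - j.l|)
    refine abs_le.2 ⟨?_, ?_⟩ <;> dsimp only <;> linarith
  · exact hx'.symm.trans (map_intCast _ x).symm

theorem Gap.exists_int_close_right (j : Gap D cantorSet) {z : Z D cantorSet} {N : ℕ}
    (hz : |Z.q z - j.r| < 1 / (N + 1 : ℝ)) (B : ℤ) {γ γ' : cantorSet}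
    (hγ : ∀ i < N, cantorDigits γ i = cantorDigits γ' i) :
    ∃ x : ℤ, B ≤ x ∧ Close N (z, γ) (j.pt (.int x), γ') := by
  obtain ⟨B', hB'⟩ := j.exists_q_near (sub_pos.2 hz)
  obtain ⟨x, hx, hx'⟩ := Theta.exists_int_ge N (Theta.red N (Z.zeta z)) (max B B')
  refine ⟨x, (le_max_left _ _).trans hx, ?_, ?_, hγ⟩
  · have h1 := (hB' x).2 ((le_max_right _ _).trans hx)
    have h2 := (j.q_int_mem x).2
    have h3 := abs_le.1 (le_refl |Z.q z - j.r|)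
    refine abs_le.2 ⟨?_, ?_⟩ <;> dsimp only <;> linarith
  · exact hx'.symm.trans (map_intCast _ x).symm

section

variable {n : ℕ} {φ : X D cantorSet → W n}

theorem IsActionMap.rel (hφ : IsActionMap (T D cantorSet) φ) (x : X D cantorSet) :
    W.Rel n (φ x) (φ (T D cantorSet x)) := by
  rw [← hφ.map_rel]
  exact ⟨x, _, rfl, rfl, rfl⟩

theorem IsActionMap.rel_pt (hφ : IsActionMap (T D cantorSet) φ) (j : Gap D cantorSet)
    (γ : cantorSet) (x : ℤ) :
    W.Rel n (φ (j.pt (.int x), γ)) (φ (j.pt (.int (x + 1)), γ)) :=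
  hφ.rel (j.pt (.int x), γ)

theorem IsActionMap.fst_eq (hφ : IsActionMap (T D cantorSet) φ) (j : Gap D cantorSet)
    (γ : cantorSet) (x : ℤ) : (φ (j.pt (.int x), γ)).1 = (φ (j.pt (.int 0), γ)).1 := by
  induction x using Int.induction_on with
  | zero => rfl
  | succ i ih => rw [← (hφ.rel_pt j γ i).1, ih]
  | pred i ih =>
    have h := (hφ.rel_pt j γ (-(i : ℤ) - 1)).1
    rw [sub_add_cancel] at h
    rw [h, ih]

theorem IsActionMap.exists_orbit_eq (hφ : IsActionMap (T D cantorSet) φ) (j : Gap D cantorSet)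
    (γ : cantorSet) : ∃ (ω : Fin n → Letter) (K : Kind) (c : ℤ), ∀ x : ℤ,
      φ (j.pt (.int x), γ) = (ω, FinSpiral.ofSpiral n (Spiral.collapse K (.int (x + c)))) := by
  obtain ⟨K, c, h⟩ := FinSpiral.exists_walk_eq fun x => (hφ.rel_pt j γ x).2
  exact ⟨_, K, c, fun x => Prod.ext (hφ.fst_eq j γ x) (h x)⟩

variable {N : ℕ}

/-- An action map is determined near a gap by the image of the orbit of the gap. -/
theorem eq_of_orbit_eq (hnN : n ≤ N) (hN : ∀ x y, Close N x y → φ x = φ y) {j : Gap D cantorSet}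
    {γ γ' : cantorSet} (hγ : ∀ i < N, cantorDigits γ i = cantorDigits γ' i)
    {ω : Fin n → Letter} {K : Kind} {c : ℤ}
    (h : ∀ x : ℤ, φ (j.pt (.int x), γ') =
      (ω, FinSpiral.ofSpiral n (Spiral.collapse K (.int (x + c)))))
    {z : Z D cantorSet} (hl : j.l - 1 / (N + 1 : ℝ) < Z.q z) (hr : Z.q z < j.r + 1 / (N + 1 : ℝ)) :
    φ (z, γ) = (ω, FinSpiral.ofSpiral n (Spiral.collapse K ((j.proj z).translate c))) := by
  have hp : (0 : ℝ) < 1 / (N + 1 : ℝ) := by positivity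
  rcases j.trichotomy z with hz | hz | ⟨x, rfl⟩
  · obtain ⟨x, hx, hc⟩ := j.exists_int_close_left (z := z) (N := N)
      -- The bound puts `x + c` at or below `-n`, in the range identified with the left end.
      (abs_lt.2 ⟨by linarith, by linarith⟩) (-n - c) hγ
    rw [hN _ _ hc, h]
    refine Prod.ext rfl (FinSpiral.ofSpiral_collapse_eq K ?_ ?_)
    · rw [Spiral.zeta_translate, j.zeta_proj, map_add, Theta.red_eq_of_le hnN hc.2.1, ← map_add]
      exact congrArg _ (Int.cast_add x c)
    · refine Eq.trans ?_ (j.clamp_toFin_of_le c n hz).symm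
      change max (-(n : ℤ)) (min (x + c) n) = -n
      omega
  · obtain ⟨x, hx, hc⟩ := j.exists_int_close_right (z := z) (N := N)
      (abs_lt.2 ⟨by linarith, by linarith⟩) (n - c) hγ
    rw [hN _ _ hc, h]
    refine Prod.ext rfl (FinSpiral.ofSpiral_collapse_eq K ?_ ?_)
    · rw [Spiral.zeta_translate, j.zeta_proj, map_add, Theta.red_eq_of_le hnN hc.2.1, ← map_add]
      exact congrArg _ (Int.cast_add x c)
    · refine Eq.trans ?_ (j.clamp_toFin_of_ge c n hz).symm
      change max (-(n : ℤ)) (min (x + c) n) = n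
      omega
  · rw [hN (j.pt (.int x), γ) (j.pt (.int x), γ') ⟨by simpa using hp.le, rfl, hγ⟩, h, j.proj_int]
    rfl

/-- For every word there are three different gaps, with images of the three kinds in the finite
spiral of that word. -/
theorem IsActionMap.exists_gaps (hφ : IsActionMap (T D cantorSet) φ) (hnN : n ≤ N)
    (hN : ∀ x y, Close N x y → φ x = φ y) (ω : Fin n → Letter) :
    ∃ (γ : cantorSet) (j : Kind → Gap D cantorSet) (c : ℤ), Function.Injective j ∧
      ∀ K (x : ℤ), φ ((j K).pt (.int x), γ) =
        (ω, FinSpiral.ofSpiral n (Spiral.collapse K (.int (x + c)))) := by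
  have hp : (0 : ℝ) < 1 / (N + 1 : ℝ) := by positivity
  obtain ⟨⟨z, γ⟩, hz⟩ := hφ.surjective (ω, FinSpiral.mk n (.int 0))
  obtain ⟨j, y, hy⟩ : ∃ (j : Gap D cantorSet) (y : ℤ),
      φ (j.pt (.int y), γ) = (ω, FinSpiral.mk n (.int 0)) := by
    rcases z.eq_machine_or_eq_pt with ⟨a, t, rfl⟩ | ⟨j, y, rfl⟩
    -- A preimage on an adding machine is moved to the wandering orbit of a nearby gap, where `φ`
    -- has the same value.
    · obtain ⟨j, hj, -⟩ := exists_gap_near a.2 hp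
      rw [abs_sub_comm] at hj
      obtain ⟨y, -, hy⟩ := j.exists_int_close_left (z := Z.machine a t) hj 0
        (γ := γ) fun _ _ => rfl
      exact ⟨j, y, (hN _ _ hy).symm.trans hz⟩
    · exact ⟨j, y, hz⟩
  have hM : ∀ x : ℤ, φ (j.pt (.int x), γ) = (ω, FinSpiral.ofSpiral n (.int (x + -y))) := fun x => by
    refine Prod.ext ?_ ?_
    · rw [hφ.fst_eq, ← hφ.fst_eq j γ y, hy]
    · have h := FinSpiral.walk_eq_mk_int (fun x => (hφ.rel_pt j γ x).2) (Or.inl rfl)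
        (congrArg Prod.snd hy) x
      rw [h, add_zero]
      rfl
  -- The two further gaps are so close to the ends of `j` that `φ` takes on their orbits the values
  -- of far points of the orbit of `j`, which lie in the end cycles.
  obtain ⟨a, ha, ha'⟩ := j.exists_mem_left hp
  obtain ⟨jl, hl1, hl2⟩ := exists_gap_Ioo ha ha'
  obtain ⟨b, hb, hb'⟩ := j.exists_mem_right hp
  obtain ⟨jr, hr1, hr2⟩ := exists_gap_Ioo hb hb'
  have h1 := j.lt
  have h2 := jl.lt
  have h3 := jr.lt
  refine ⟨γ, fun | .L => jl | .M => j | .R => jr, -y, ?_, ?_⟩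
  · rintro (_ | _ | _) (_ | _ | _) h <;> first
    | rfl
    | (have := congrArg Gap.l h
       simp only at this
       linarith)
  · rintro (_ | _ | _) x
    · have hx := jl.q_int_mem x
      obtain ⟨x', hx', hc⟩ := j.exists_int_close_left (z := jl.pt (.int x)) (N := N)
        (abs_lt.2 ⟨by linarith [hx.1], by linarith [hx.2]⟩) (-n + y) (γ := γ) fun _ _ => rfl
      refine (hN _ _ hc).trans ((hM x').trans (Prod.ext rfl ?_))
      refine (FinSpiral.ofSpiral_int_of_le (by omega)).trans (FinSpiral.ofSpiral_negInf_eq ?_)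
      have h := Theta.red_eq_of_le hnN hc.2.1
      change Theta.red n (x : Theta) = Theta.red n (x' : Theta) at h
      change _ = Theta.red n ((x + -y : ℤ) : Theta)
      rw [Int.cast_add, Int.cast_add, map_add, map_add, h]
    · exact hM x
    · have hx := jr.q_int_mem x
      obtain ⟨x', hx', hc⟩ := j.exists_int_close_right (z := jr.pt (.int x)) (N := N)
        (abs_lt.2 ⟨by linarith [hx.1], by linarith [hx.2]⟩) (n + y) (γ := γ) fun _ _ => rfl
      refine (hN _ _ hc).trans ((hM x').trans (Prod.ext rfl ?_))
      refine (FinSpiral.ofSpiral_int_of_ge (by omega)).trans (FinSpiral.ofSpiral_posInf_eq ?_)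
      have h := Theta.red_eq_of_le hnN hc.2.1
      change Theta.red n (x : Theta) = Theta.red n (x' : Theta) at h
      change _ = Theta.red n ((x + -y : ℤ) : Theta)
      rw [Int.cast_add, Int.cast_add, map_add, map_add, h]

end

/-! ### Cantor digits, words and selections -/

instance : Finite Kind := by
  refine Finite.of_surjective (fun i : Fin 3 => (![Kind.L, Kind.M, Kind.R] : Fin 3 → Kind) i) ?_
  rintro (_ | _ | _)
  · exact ⟨0, rfl⟩
  · exact ⟨1, rfl⟩
  · exact ⟨2, rfl⟩

/-- The first `N` binary digits of a point of the Cantor set. -/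
def cantorPrefix (N : ℕ) (γ : cantorSet) : Fin N → Bool := fun i => cantorDigits γ i

/-- The binary digits of a point of the Cantor set from position `N` on. -/
def cantorTail (N : ℕ) (γ : cantorSet) : ℕ → Bool := fun i => cantorDigits γ (N + i)

theorem continuous_cantorPrefix (N : ℕ) : Continuous (cantorPrefix N) :=
  continuous_pi fun i => (continuous_apply (i : ℕ)).comp continuous_cantorDigits

theorem continuous_cantorTail (N : ℕ) : Continuous (cantorTail N) :=
  continuous_pi fun i => (continuous_apply (N + i)).comp continuous_cantorDigits

theorem exists_prefix_tail_eq (N : ℕ) (b : Fin N → Bool) (d : ℕ → Bool) :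
    ∃ γ, cantorPrefix N γ = b ∧ cantorTail N γ = d := by
  obtain ⟨γ, hγ⟩ := cantorDigits_bijective.2 fun m => if h : m < N then b ⟨m, h⟩ else d (m - N)
  refine ⟨γ, funext fun i => ?_, funext fun i => ?_⟩
  · rw [cantorPrefix, hγ]
    exact dif_pos i.2
  · rw [cantorTail, hγ]
    exact (dif_neg (by omega)).trans (by rw [Nat.add_sub_cancel_left])

/-- Finitely many binary digits suffice to encode the elements of `U`; digit strings that encode
nothing get an arbitrary value. -/
theorem exists_isLocallyConstant_surjective (U : Type) [Finite U] [Nonempty U] :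
    ∃ s : (ℕ → Bool) → U, IsLocallyConstant s ∧ Function.Surjective s := by
  have := Fintype.ofFinite U
  obtain ⟨g⟩ : Nonempty (U ↪ (Fin (Fintype.card U) → Bool)) :=
    Function.Embedding.nonempty_of_card_le (by
      simpa using Nat.lt_two_pow_self.le)
  refine ⟨fun d => Function.invFun g fun i => d i, ?_, ?_⟩
  · have hc : Continuous fun (d : ℕ → Bool) (i : Fin (Fintype.card U)) => d i :=
      continuous_pi fun i => continuous_apply (i : ℕ)
    exact (IsLocallyConstant.iff_continuous _).2 hc |>.comp (Function.invFun g)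
  · intro u
    obtain ⟨b, hb⟩ := Function.invFun_surjective g.injective u
    refine ⟨fun m => if h : m < Fintype.card U then b ⟨m, h⟩ else false, ?_⟩
    rw [← hb]
    exact congrArg _ (funext fun i => dif_pos i.2)

/-- The words of length `n + k` can be mapped onto a finite set over the words of length `n` and
the kinds, for large `k`. -/
theorem exists_word_map {P : Type} [Finite P] {n k : ℕ} {f : P → (Fin n → Letter) × Kind}
    (hf : Function.Surjective f) (hk : Nat.card P ≤ k) (hk' : 0 < k) :
    ∃ h : (Fin (n + k) → Letter) → P, Function.Surjective h ∧
      ∀ u, f (h u) = (fun i => u (Fin.castAdd k i), W.kind n k u) := by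
  have he : ∀ t, ∃ e : (Fin k → Fin 2) → {x // f x = t}, Function.Surjective e := fun t => by
    have := Fintype.ofFinite {x // f x = t}
    have : Nonempty {x // f x = t} := (hf t).elim fun x hx => ⟨⟨x, hx⟩⟩
    obtain ⟨g⟩ : Nonempty ({x // f x = t} ↪ (Fin k → Fin 2)) :=
      Function.Embedding.nonempty_of_card_le (by
        rw [← Nat.card_eq_fintype_card]
        refine (Finite.card_subtype_le _).trans (hk.trans ?_)
        simpa using Nat.lt_two_pow_self.le)
    exact ⟨_, Function.invFun_surjective g.injective⟩
  choose e he using he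
  refine ⟨fun u => e (fun i => u (Fin.castAdd k i), W.kind n k u) fun i => (u (Fin.natAdd n i)).2,
    fun x => ?_, fun u => (e _ _).2⟩
  obtain ⟨a, ha⟩ := he (f x) ⟨x, rfl⟩
  -- The kind is repeated `k` times, and the indices of the letters spell the code `a` of `x`.
  let u : Fin (n + k) → Letter := Fin.append (f x).1 fun i => ((f x).2, a i)
  have h1 : (fun i => u (Fin.castAdd k i)) = (f x).1 := funext fun i => Fin.append_left _ _ i
  have h2 : ∀ i, u (Fin.natAdd n i) = ((f x).2, a i) := fun i => Fin.append_right _ _ i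
  have h3 : W.kind n k u = (f x).2 := W.kind_eq n k u (fun i => by rw [h2]) hk'
  have h4 : (fun i => (u (Fin.natAdd n i)).2) = a := funext fun i => by rw [h2]
  have h5 : (fun i => u (Fin.castAdd k i), W.kind n k u) = f x := Prod.ext h1 h3
  refine ⟨u, ?_⟩
  dsimp only
  rw [h5, h4, ha]

/-- A choice function of a relation that extends a given injective partial inverse. -/
theorem exists_surjective_selection {P Q : Type*} {A : P → Q → Prop} (hA : ∀ p, ∃ t, A p t)
    {s : Q → P} (hs : Function.Injective s) (hsA : ∀ t, A (s t) t) :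
    ∃ f : P → Q, Function.Surjective f ∧ ∀ p, A p (f p) := by
  classical
  choose g hg using hA
  refine ⟨fun p => if h : ∃ t, s t = p then h.choose else g p, fun t => ⟨s t, ?_⟩, fun p => ?_⟩
  · have h : ∃ t', s t' = s t := ⟨t, rfl⟩
    simp only [dif_pos h]
    exact hs h.choose_spec
  · by_cases h : ∃ t, s t = p
    · simp only [dif_pos h]
      have := hsA h.choose
      rwa [h.choose_spec] at this
    · simp only [dif_neg h]
      exact hg p

/-! ### Construction of the lift -/

theorem Gap.toFin_shift {A A₀ : Set ℝ} (j : Gap A A₀) (c : ℤ) (N : ℕ) (z : Z A A₀) :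
    j.toFin c N (Z.shift A A₀ z) = FinSpiral.ofSpiral N ((j.proj z).translate c).shift := by
  rw [toFin, proj_shift, Spiral.translate_shift]

/-- The Lifting Property, with a neighborhood of the diagonal in the place of a metric. -/
theorem exists_lift {n : ℕ} {φ : X D cantorSet → W n} (hφ : IsActionMap (T D cantorSet) φ)
    {S : Set (X D cantorSet × X D cantorSet)} (hS : IsClosed S) (hd : ∀ x, (x, x) ∉ S) :
    ∃ k : ℕ, 0 < k ∧ ∃ ρ : X D cantorSet → W (n + k), IsActionMap (T D cantorSet) ρ ∧
      (∀ x y, ρ x = ρ y → (x, y) ∉ S) ∧ φ = W.xiIter n k ∘ ρ := by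
  -- a scale at which `φ` is constant and `S` is not visible
  obtain ⟨N, hnN, hNφ, hNS⟩ : ∃ N, n ≤ N ∧ (∀ x y, Close N x y → φ x = φ y) ∧
      ∀ x y, Close N x y → (x, y) ∉ S := by
    have hc : IsClosed {p : X D cantorSet × X D cantorSet | φ p.1 ≠ φ p.2} :=
      ((isOpen_discrete (Set.diagonal (W n))).preimage
        ((hφ.continuous.comp continuous_fst).prodMk
          (hφ.continuous.comp continuous_snd))).isClosed_compl
    obtain ⟨N, hN⟩ := exists_close_notMem (hS.union hc) fun x h => h.elim (hd x) fun h => h rfl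
    refine ⟨max n N, le_max_left _ _, fun x y h => ?_, fun x y h hxy => ?_⟩
    · by_contra hne
      exact hN x y (h.mono (le_max_right _ _)) (Or.inr hne)
    · exact hN x y (h.mono (le_max_right _ _)) (Or.inl hxy)
  -- the pieces
  choose γ j c₀ hj hjφ using hφ.exists_gaps hnN hNφ
  have hp : (0 : ℝ) < 1 / (N + 1 : ℝ) := by positivity
  -- The bound `2 * δ` controls pairs of points on the two sides of an end of a gap. The bound by
  -- the lengths makes each gap `j ω K` the designated gap of its piece: any other designated gap is
  -- disjoint from it, and would leave part of it at distance at least `δ`.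
  obtain ⟨δ, hδ, hδN, hδj⟩ : ∃ δ : ℝ, 0 < δ ∧ 2 * δ ≤ 1 / (N + 1 : ℝ) ∧
      ∀ ω K, δ ≤ (j ω K).r - (j ω K).l := by
    have : Nonempty ((Fin n → Letter) × Kind) := ⟨(fun _ => (.M, 0), .M)⟩
    obtain ⟨t, ht⟩ := Finite.exists_min fun t : (Fin n → Letter) × Kind =>
      (j t.1 t.2).r - (j t.1 t.2).l
    have h1 := min_le_left (1 / (N + 1 : ℝ) / 2) ((j t.1 t.2).r - (j t.1 t.2).l)
    exact ⟨min (1 / (N + 1 : ℝ) / 2) ((j t.1 t.2).r - (j t.1 t.2).l),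
      lt_min (half_pos hp) (sub_pos.2 (j t.1 t.2).lt), by linarith,
      fun ω K => (min_le_right _ _).trans (ht (ω, K))⟩
  obtain ⟨I, _, ι, J, hι, hιs, hιj, hιJ, hJ⟩ := exists_partition hδ
  have hJj : ∀ ω K, J (ι ((j ω K).pt (.int 0))) = j ω K := fun ω K => by
    by_contra hne
    have h1 := (hJ ((j ω K).pt (.negInf 0))).1
    have h2 := (hJ ((j ω K).pt (.posInf 0))).2
    rw [hιj _ _ (.int 0), Gap.q_negInf] at h1
    rw [hιj _ _ (.int 0), Gap.q_posInf] at h2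
    have := hδj ω K
    rcases Gap.le_or_le_of_ne hne with h | h <;> linarith
  have hδN' : δ ≤ 1 / (N + 1 : ℝ) := by linarith
  have hJ' : ∀ i z, ι z = i → (J i).l - 1 / (N + 1 : ℝ) < Z.q z ∧
      Z.q z < (J i).r + 1 / (N + 1 : ℝ) := fun i z hz => by
    subst hz
    have := hJ z
    exact ⟨by linarith, by linarith⟩
  -- the kinds of the pieces
  let A : I × (Fin N → Bool) → (Fin n → Letter) × Kind → Prop := fun P t => ∃ c : ℤ, ∀ z γ,
    ι z = P.1 → cantorPrefix N γ = P.2 → φ (z, γ) =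
      (t.1, FinSpiral.ofSpiral n (Spiral.collapse t.2 (((J P.1).proj z).translate c)))
  have hpre : ∀ {γ γ' : cantorSet}, cantorPrefix N γ = cantorPrefix N γ' →
      ∀ i < N, cantorDigits γ i = cantorDigits γ' i := fun h i hi => congrFun h ⟨i, hi⟩
  have hA : ∀ P, ∃ t, A P t := fun ⟨i, b⟩ => by
    obtain ⟨γ₀, rfl, -⟩ := exists_prefix_tail_eq N b fun _ => false
    obtain ⟨ω, K, c, h⟩ := hφ.exists_orbit_eq (J i) γ₀
    exact ⟨(ω, K), c, fun z γ hz hγ =>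
      eq_of_orbit_eq hnN hNφ (hpre hγ) h (hJ' i z hz).1 (hJ' i z hz).2⟩
  let s : (Fin n → Letter) × Kind → I × (Fin N → Bool) := fun t =>
    (ι ((j t.1 t.2).pt (.int 0)), cantorPrefix N (γ t.1))
  have hsA : ∀ t, A (s t) t := fun ⟨ω, K⟩ => by
    refine ⟨c₀ ω, fun z γ' hz hγ => ?_⟩
    have h := hJ' _ z hz
    exact eq_of_orbit_eq hnN hNφ (hpre hγ) (fun x => by
      change φ ((J (ι ((j ω K).pt (.int 0)))).pt (.int x), γ ω) = _
      rw [hJj, hjφ]) h.1 h.2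
  have hs : Function.Injective s := fun ⟨ω, K⟩ ⟨ω', K'⟩ h => by
    obtain ⟨c, hc⟩ := hsA (ω, K)
    obtain ⟨c', hc'⟩ := hsA (ω', K')
    obtain rfl : ω = ω' := congrArg Prod.fst ((hc _ _ rfl rfl).symm.trans
      (hc' _ _ (congrArg Prod.fst h) (congrArg Prod.snd h)))
    have hJ := congrArg J (congrArg Prod.fst h)
    change J (ι ((j ω K).pt (.int 0))) = J (ι ((j ω K').pt (.int 0))) at hJ
    rw [hJj, hJj] at hJ
    rw [hj ω hJ]
  -- Types need not be unique: for `n = 0` all three kinds give the same map. Prescribing the types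
  -- of the pieces `s t` ensures that every type is selected.
  obtain ⟨f, hf, hfA⟩ := exists_surjective_selection hA hs hsA
  choose c hc using hfA
  -- the words
  obtain ⟨k, hk, hkP, hkN, hkc⟩ : ∃ k : ℕ, 0 < k ∧ Nat.card (I × (Fin N → Bool)) ≤ k ∧ N ≤ n + k ∧
      ∀ P z w, (J P.1).toFin (c P) (n + k) z = (J P.1).toFin (c P) (n + k) w →
        Theta.red (n + k) (Z.zeta z) = Theta.red (n + k) (Z.zeta w) ∧ (z = w ∨
          (Z.q z < (J P.1).l + δ ∧ Z.q w < (J P.1).l + δ) ∨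
          ((J P.1).r - δ < Z.q z ∧ (J P.1).r - δ < Z.q w)) := by
    choose N₀ hN₀ using fun P => (J P.1).eq_or_near_of_toFin_eq hδ (c P)
    obtain ⟨M, hM⟩ := (finite_range N₀).bddAbove
    refine ⟨Nat.card (I × (Fin N → Bool)) + N + M + 1, by omega, by omega, by omega, fun P => ?_⟩
    exact hN₀ P _ ((hM ⟨P, rfl⟩).trans (by omega))
  obtain ⟨h, hh, hhf⟩ := exists_word_map hf hkP hk
  have hne : ∀ P, Nonempty {u // h u = P} := fun P => (hh P).elim fun u hu => ⟨⟨u, hu⟩⟩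
  -- The digits from position `N` on distribute the points of `P` among all the words assigned to
  -- `P`.
  choose w hwc hws using fun P => exists_isLocallyConstant_surjective {u // h u = P}
  -- the lift
  let ρ : X D cantorSet → W (n + k) := fun x =>
    ((w (ι x.1, cantorPrefix N x.2) (cantorTail N x.2)).1,
      (J (ι x.1)).toFin (c (ι x.1, cantorPrefix N x.2)) (n + k) x.1)
  have hρh : ∀ x, h (ρ x).1 = (ι x.1, cantorPrefix N x.2) := fun x => (w _ _).2
  have hρT : ∀ x, ρ (T D cantorSet x) = ((ρ x).1, FinSpiral.ofSpiral (n + k)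
      (((J (ι x.1)).proj x.1).translate (c (ι x.1, cantorPrefix N x.2))).shift) := fun x => by
    change ((w (ι (Z.shift D cantorSet x.1), cantorPrefix N x.2) (cantorTail N x.2)).1,
      (J (ι (Z.shift D cantorSet x.1))).toFin
        (c (ι (Z.shift D cantorSet x.1), cantorPrefix N x.2)) (n + k)
        (Z.shift D cantorSet x.1)) = _
    rw [hιs, Gap.toFin_shift]
  -- The spiral of the designated gap, with tail digits that select `u`, already covers the finite
  -- spiral of `u` and all its pairs in the relation.
  have honto : ∀ (u : Fin (n + k) → Letter) (p : Spiral Theta), ∃ x,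
      ρ x = (u, FinSpiral.ofSpiral (n + k) p) ∧
      ρ (T D cantorSet x) = (u, FinSpiral.ofSpiral (n + k) p.shift) := fun u p => by
    obtain ⟨d, hd⟩ := hws (h u) ⟨u, rfl⟩
    obtain ⟨γ', hγ, rfl⟩ := exists_prefix_tail_eq N (h u).2 d
    obtain ⟨p, rfl⟩ := Spiral.translate_surjective (c (h u)) p
    have hP : (ι ((J (h u).1).pt p), cantorPrefix N γ') = h u := Prod.ext (hιJ _ _) hγ
    have hx : ρ ((J (h u).1).pt p, γ') =
        (u, FinSpiral.ofSpiral (n + k) (Spiral.translate (c (h u)) p)) := by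
      refine Prod.ext ?_ ?_
      · change (w (ι ((J (h u).1).pt p), cantorPrefix N γ') (cantorTail N γ')).1 = u
        rw [hP, hd]
      · change (J (ι ((J (h u).1).pt p))).toFin
          (c (ι ((J (h u).1).pt p), cantorPrefix N γ')) (n + k) _ = _
        rw [hP, hιJ, Gap.toFin, Gap.proj_pt]
    refine ⟨_, hx, ?_⟩
    rw [hρT, hx]
    change (u, FinSpiral.ofSpiral (n + k) (Spiral.translate
      (c (ι ((J (h u).1).pt p), cantorPrefix N γ'))
      ((J (ι ((J (h u).1).pt p))).proj ((J (h u).1).pt p))).shift) = _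
    rw [hP, hιJ, Gap.proj_pt]
  refine ⟨k, hk, ρ, ⟨?_, ?_, ?_⟩, fun x y hxy => hNS x y ?_, funext fun x => ?_⟩
  · refine ((IsLocallyConstant.iff_eventually_eq ρ).2 fun x => ?_).continuous
    have e1 := (continuous_fst.tendsto x).eventually
      ((IsLocallyConstant.iff_eventually_eq _).1 hι x.1)
    have e2 := (continuous_snd.tendsto x).eventually
      ((IsLocallyConstant.iff_eventually_eq _).1
        ((IsLocallyConstant.iff_continuous _).2 (continuous_cantorPrefix N)) x.2)
    have e3 := (((continuous_cantorTail N).comp continuous_snd).tendsto x).eventually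
      ((IsLocallyConstant.iff_eventually_eq _).1 (hwc (ι x.1, cantorPrefix N x.2)) _)
    have e4 := (continuous_fst.tendsto x).eventually
      ((IsLocallyConstant.iff_eventually_eq _).1 ((J (ι x.1)).isLocallyConstant_toFin
        (c (ι x.1, cantorPrefix N x.2)) (n + k)) x.1)
    filter_upwards [e1, e2, e3, e4] with y h1 h2 h3 h4
    refine Prod.ext ?_ ?_
    · change (w (ι y.1, cantorPrefix N y.2) (cantorTail N y.2)).1 = _
      rw [h1, h2]
      exact congrArg Subtype.val h3
    · change (J (ι y.1)).toFin (c (ι y.1, cantorPrefix N y.2)) (n + k) y.1 = _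
      rw [h1, h2]
      exact h4
  · rintro ⟨u, s⟩
    obtain ⟨p, rfl⟩ := FinSpiral.ofSpiral_surjective _ s
    exact (honto u p).imp fun x hx => hx.1
  · funext a b
    refine propext ⟨?_, ?_⟩
    · rintro ⟨x, _, rfl, rfl, rfl⟩
      rw [hρT]
      exact ⟨rfl, FinSpiral.rel_ofSpiral _ _⟩
    · obtain ⟨u, a⟩ := a
      obtain ⟨v, b⟩ := b
      rintro ⟨huv, hab⟩
      obtain rfl : u = v := huv
      obtain ⟨p, rfl, rfl⟩ := FinSpiral.exists_of_rel hab
      obtain ⟨x, hx, hx'⟩ := honto u p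
      exact ⟨x, _, rfl, hx, hx'⟩
  -- The word determines the piece, so points with equal images are compared through one and the
  -- same `toFin`.
  · have hP : (ι x.1, cantorPrefix N x.2) = (ι y.1, cantorPrefix N y.2) := by
      rw [← hρh, ← hρh, hxy]
    have hι' : ι x.1 = ι y.1 := congrArg Prod.fst hP
    have hsnd : (ρ x).2 = (ρ y).2 := congrArg Prod.snd hxy
    change (J (ι x.1)).toFin (c (ι x.1, cantorPrefix N x.2)) (n + k) x.1 =
      (J (ι y.1)).toFin (c (ι y.1, cantorPrefix N y.2)) (n + k) y.1 at hsnd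
    rw [← hP, ← hι'] at hsnd
    obtain ⟨hz, hq⟩ := hkc (ι x.1, cantorPrefix N x.2) _ _ hsnd
    refine ⟨?_, Theta.red_eq_of_le hkN hz, hpre (congrArg Prod.snd hP)⟩
    have hx := hJ x.1
    have hy := hJ y.1
    rw [← hι'] at hy
    refine abs_le.2 ?_
    rcases hq with hq | hq | hq
    · rw [hq]
      constructor <;> linarith
    · constructor <;> linarith [hq.1, hq.2]
    · constructor <;> linarith [hq.1, hq.2]
  · obtain ⟨z, γ'⟩ := x
    have h1 := hc (ι z, cantorPrefix N γ') z γ' rfl rfl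
    have h2 := hhf (ρ (z, γ')).1
    rw [hρh] at h2
    rw [h1, h2]
    exact (W.xiIter_ofSpiral n k _ _).symm

end LiftingLemma

end

theorem lemma2p2
    (m : MetricSpace (LiftingLemma.X LiftingLemma.D cantorSet))
    (hm : (instTopologicalSpaceProd :
        TopologicalSpace (LiftingLemma.X LiftingLemma.D cantorSet)) =
      m.toUniformSpace.toTopologicalSpace) :
    @LiftingLemma.LiftingProperty _ (m.replaceTopology hm)
      (LiftingLemma.T LiftingLemma.D cantorSet) := by
  intro n φ hφ ε hε
  let := m.replaceTopology hm
  have hS : IsClosed {p : LiftingLemma.X LiftingLemma.D cantorSet ×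
      LiftingLemma.X LiftingLemma.D cantorSet | ε ≤ dist p.1 p.2} :=
    isClosed_le continuous_const (continuous_fst.dist continuous_snd)
  -- Pairs at distance at least `ε` form a closed set off the diagonal; a lift whose fibers avoid it
  -- has mesh at most `ε`.
  obtain ⟨k, hk, ρ, hρ, hmesh, hφρ⟩ := LiftingLemma.exists_lift hφ hS fun x h => by
    change ε ≤ dist x x at h
    rw [dist_self] at h
    exact hε.not_ge h
  refine ⟨k, hk, ρ, hρ, iSup_le fun y => Metric.ediam_le fun a ha b hb => ?_, hφρ⟩
  have h := hmesh a b (ha.trans hb.symm)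
  rw [edist_dist]
  exact ENNReal.ofReal_le_ofReal (not_le.1 h).le
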